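/- Fix $0<\varepsilon\le 1$ and $z\in\mathbb C$. For each $n$ let $s=s_n$ be an integer with $|s|\le(1-\varepsilon)n$ and $s\not\equiv n \pmod 2$, and let $F_n$ be a deterministic $n\times n$ matrix all of whose rows are equal to one given vector $\mathbf f=\mathbf f_n\in\{-1,1\}^n$. Let $X_n$ be a random $n\times n$ matrix whose rows are independent and uniformly distributed on the set of all vectors in $\{-1,1\}^n$ whose coordinates sum to $s-1$ or to $s+1$, and let $X_n'$ be a random $n\times n$ matrix, defined on the same probability space (with an arbitrary joint distribution of $X_n$ and $X_n'$), whose entries are i.i.d. copies of the random variable $x$ with $\mathbf P(x=1)=\frac12+\frac{s}{2n}$ and $\mathbf P(x=-1)=\frac12-\frac{s}{2n}$. Put $m:=\lfloor n-\log^8 n\rfloor$ (and $m:=0$ if this is negative). For a complex $n\times n$ matrix with rows $r_1,\dots,r_n\in\mathbb C^n$, the $m$-dimensional volume spanned by its first $m$ rows is $\prod_{i=1}^m \operatorname{dist}(r_i,\operatorname{span}_{\mathbb C}(r_1,\dots,r_{i-1}))$, with Euclidean distances. Let $S_1$ and $S_1'$ be the volumes spanned by the first $m$ rows of $X_n+F_n-z\sqrt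 n\,I_n$ and of $X_n'+F_n-z\sqrt n\,I_n$, respectively. Then, as $n\to\infty$, with probability at least $1-\exp(-\log^{2-o(1)}n)$ both $S_1$ and $S_1'$ are positive and $$\frac1n\,\bigl|\log S_1-\log S_1'\bigr| = O(\log^{-2}n),$$ where the implied constant and the $o(1)$ term depend only on $\varepsilon$ and $z$ (and not on $s_n$, $\mathbf f_n$ or the joint distribution of $X_n$ and $X_n'$). -/

import Mathlib

open MeasureTheory ProbabilityTheory Filter Topology

noncomputable section

/-- The set of all `(-1,1)` vectors of length `n` whose coordinates sum to `s - 1` or `s + 1`. -/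
def signVectors (n : ℕ) (s : ℤ) : Set (Fin n → ℤ) :=
  {x | (∀ j, x j = 1 ∨ x j = -1) ∧ (∑ j, x j = s - 1 ∨ ∑ j, x j = s + 1)}

/-- The law on `{-1, 1}` giving mass `1/2 + s/(2n)` to `1` and mass `1/2 - s/(2n)` to `-1`. -/
def bernoulliLaw (n : ℕ) (s : ℤ) : Measure ℤ :=
  ENNReal.ofReal (1 / 2 + (s : ℝ) / (2 * n)) • Measure.dirac 1
    + ENNReal.ofReal (1 / 2 - (s : ℝ) / (2 * n)) • Measure.dirac (-1)

/-- `X` is a random matrix whose rows are independent, each of them uniformly distributed on the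
set of `(-1,1)` vectors of sum `s - 1` or `s + 1`. -/
structure IsRowSumMatrix {Ω : Type*} [MeasurableSpace Ω] (P : Measure Ω) (n : ℕ) (s : ℤ)
    (X : Ω → Matrix (Fin n) (Fin n) ℤ) : Prop where
  law : ∀ i, HasLaw (fun ω => X ω i) (uniformOn (signVectors n s)) P
  indep : iIndepFun (fun (i : Fin n) ω => X ω i) P

/-- `X'` is a random matrix whose entries are independent copies of the Bernoulli variable with
`P(x = 1) = 1/2 + s/(2n)` and `P(x = -1) = 1/2 - s/(2n)`. -/
structure IsBernoulliMatrix {Ω : Type*} [MeasurableSpace Ω] (P : Measure Ω) (n : ℕ) (s : ℤ)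
    (X' : Ω → Matrix (Fin n) (Fin n) ℤ) : Prop where
  law : ∀ i j, HasLaw (fun ω => X' ω i j) (bernoulliLaw n s) P
  indep : iIndepFun (fun (ij : Fin n × Fin n) ω => X' ω ij.1 ij.2) P

/-- The matrix `X + F - z √n I`, where all the rows of `F` are equal to `f`. -/
def shiftedMatrix {n : ℕ} (f : Fin n → ℤ) (z : ℂ) (X : Matrix (Fin n) (Fin n) ℤ) :
    Matrix (Fin n) (Fin n) ℂ :=
  X.map (fun a => (a : ℂ)) + Matrix.of (fun _ j => (f j : ℂ))
    - (z * (Real.sqrt n : ℂ)) • (1 : Matrix (Fin n) (Fin n) ℂ)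

/-- The `i`-th row of `M`, as a vector of the Hermitian space `ℂⁿ`. -/
def rowVec {n : ℕ} (M : Matrix (Fin n) (Fin n) ℂ) (i : Fin n) : EuclideanSpace ℂ (Fin n) :=
  WithLp.toLp 2 (M i)

/-- The complex span of the rows of `M` that precede the `i`-th row. -/
def prevSpan {n : ℕ} (M : Matrix (Fin n) (Fin n) ℂ) (i : Fin n) :
    Submodule ℂ (EuclideanSpace ℂ (Fin n)) :=
  Submodule.span ℂ (rowVec M '' {j | j < i})

/-- The volume spanned by the first `m` rows of `M` (base times height): the product over these
rows of the Euclidean distance of the row to the span of the preceding ones. -/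
def rowVolume {n : ℕ} (m : ℕ) (M : Matrix (Fin n) (Fin n) ℂ) : ℝ :=
  ∏ i ∈ Finset.univ.filter (fun i : Fin n => (i : ℕ) < m),
    Metric.infDist (rowVec M i) (prevSpan M i : Set (EuclideanSpace ℂ (Fin n)))

/-- The threshold `n - log⁸ n`, rounded down to an integer. -/
def threshold (n : ℕ) : ℕ := ⌊(n : ℝ) - Real.log n ^ 8⌋₊

end

/-! Each of the two log-volumes concentrates around a deterministic value and the two values are
close, so the joint law of the matrices is irrelevant and a union bound concludes. The log-volume
itself is too singular for this. It is replaced by `regLogDet`, the logarithm of det(τ + ∑ r_i r_i*)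
over the first m rows, with τ = n^(3/4); up to the deterministic term (m - n) log τ, this
approximates twice the log-volume.

Concentration: moving one row by a vector v changes `regLogDet` by at most 2‖v‖/√τ
(`abs_regLogDet_sub_le`). This follows from the rank-one determinant formula and the variational
bound `mul_regForm_le`. As the rows are independent, McDiarmid's inequality `prodProb_abs_sub_ge_le`
gives fluctuations below n/log² n.

Comparison of means: the rows are exchanged one by one between the two laws. Both laws are invariant
under permutations of coordinates, so after symmetrization only the sum of a row matters. The sums
typically differ by O(√n), which amounts to a Euclidean distance O(n^(1/4)), and the total cost is
O(n · n^(1/4)/√τ) = O(n^(7/8)) (`abs_prodExp_rowLogDet_sub_le`).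

Regularization error: let d_i be the distance of row i to the span of the earlier rows and N_i its
regularized quadratic form. The error is the sum of the nonnegative terms log(τ(1 + N_i)/d_i²). Over
the first k ≈ n - n/log³ n rows it is at most τ times the sum of the squared norms of the dual
basis, which are controlled by the distance of each row to the span of the other k - 1
(`exists_biorthogonal`, `norm_sq_le_of_biorthogonal`). The other O(n/log³ n) rows cost O(log n) each
as soon as d_i ≥ 1.

The distance bounds come from Talagrand's inequality on the biased cube (`talagrand_convex`,
`prodProb_infDist_le`). The entries of a row of prescribed sum are dependent, but its law has
density at most 2(n + 1)/ε relative to the Bernoulli row (`layerWeight_le`). Each distance estimate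
randomizes a single row, so this polynomial factor is harmless. -/

/-! ### Finite product laws and bounded differences -/

/-- The expectation of `F` when the coordinates are independent with common weights `w`. -/
noncomputable def prodExp {α : Type*} [Fintype α] {n : ℕ} (w : α → ℝ)
    (F : (Fin n → α) → ℝ) : ℝ :=
  ∑ a, (∏ i, w (a i)) * F a

section prodExp

variable {α : Type*} [Fintype α] {n : ℕ} {w : α → ℝ}

theorem prodExp_zero (w : α → ℝ) (F : (Fin 0 → α) → ℝ) : prodExp w F = F Fin.elim0 := by
  unfold prodExp
  rw [Fintype.sum_unique]
  simp only [Finset.univ_eq_empty, Finset.prod_empty, one_mul]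
  congr 1

theorem prodExp_insertNth (w : α → ℝ) (i : Fin (n + 1)) (F : (Fin (n + 1) → α) → ℝ) :
    prodExp w F = ∑ b, w b * prodExp w (fun a => F (i.insertNth b a)) := by
  unfold prodExp
  rw [← (Fin.insertNthEquiv (fun _ => α) i).sum_comp, Fintype.sum_prod_type]
  refine Finset.sum_congr rfl fun b _ => ?_
  rw [Finset.mul_sum]
  refine Finset.sum_congr rfl fun a _ => ?_
  simp [Fin.insertNthEquiv, Fin.prod_univ_succAbove _ i, mul_assoc]

theorem prodExp_succ (w : α → ℝ) (F : (Fin (n + 1) → α) → ℝ) :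
    prodExp w F = ∑ b, w b * prodExp w (fun a => F (Fin.cons b a)) := by
  rw [prodExp_insertNth w 0]
  simp

theorem prodExp_mono (hw : ∀ b, 0 ≤ w b) {F G : (Fin n → α) → ℝ} (h : ∀ a, F a ≤ G a) :
    prodExp w F ≤ prodExp w G :=
  Finset.sum_le_sum fun a _ =>
    mul_le_mul_of_nonneg_left (h a) (Finset.prod_nonneg fun _ _ => hw _)

theorem prodExp_nonneg (hw : ∀ b, 0 ≤ w b) {F : (Fin n → α) → ℝ} (h : ∀ a, 0 ≤ F a) :
    0 ≤ prodExp w F :=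
  Finset.sum_nonneg fun a _ => mul_nonneg (Finset.prod_nonneg fun _ _ => hw _) (h a)

theorem prodExp_add (F G : (Fin n → α) → ℝ) :
    prodExp w (fun a => F a + G a) = prodExp w F + prodExp w G := by
  simp [prodExp, mul_add, Finset.sum_add_distrib]

theorem prodExp_sub (F G : (Fin n → α) → ℝ) :
    prodExp w (fun a => F a - G a) = prodExp w F - prodExp w G := by
  simp [prodExp, mul_sub, Finset.sum_sub_distrib]

theorem prodExp_const_mul (c : ℝ) (F : (Fin n → α) → ℝ) :
    prodExp w (fun a => c * F a) = c * prodExp w F := by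
  simp only [prodExp, Finset.mul_sum]
  exact Finset.sum_congr rfl fun a _ => by ring

theorem prodExp_finset_sum {ι : Type*} (s : Finset ι) (F : ι → (Fin n → α) → ℝ) :
    prodExp w (fun a => ∑ i ∈ s, F i a) = ∑ i ∈ s, prodExp w (F i) := by
  simp only [prodExp, Finset.mul_sum]
  exact Finset.sum_comm

theorem prodExp_const (hw1 : ∑ b, w b = 1) (c : ℝ) :
    prodExp w (fun _ : Fin n → α => c) = c := by
  induction n with
  | zero => rw [prodExp_zero]
  | succ n ih => rw [prodExp_succ]; simp [ih, ← Finset.sum_mul, hw1]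

theorem sum_prod_eq_one (hw1 : ∑ b, w b = 1) : ∑ a : Fin n → α, ∏ i, w (a i) = 1 := by
  simpa [prodExp] using prodExp_const (n := n) hw1 1

/-- Resampling one coordinate does not change the expectation. -/
theorem prodExp_resample (hw1 : ∑ b, w b = 1) (i : Fin n) (F : (Fin n → α) → ℝ) :
    prodExp w (fun a => ∑ b, w b * F (Function.update a i b)) = prodExp w F := by
  cases n with
  | zero => exact i.elim0
  | succ n =>
    rw [prodExp_insertNth w i, prodExp_insertNth w i]
    simp only [Fin.update_insertNth]
    rw [← Finset.sum_mul, hw1, one_mul, prodExp_finset_sum]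
    exact Finset.sum_congr rfl fun b _ => by rw [prodExp_const_mul]

/-- Hoeffding's lemma for a finitely supported law. -/
theorem sum_mul_exp_le (hw : ∀ b, 0 ≤ w b) (hw1 : ∑ b, w b = 1) {g : α → ℝ} {B : ℝ}
    (hg : ∀ b c, |g b - g c| ≤ B) (l : ℝ) :
    ∑ b, w b * Real.exp (l * g b) ≤
      Real.exp (l * ∑ b, w b * g b) * Real.exp (l ^ 2 * B ^ 2 / 2) := by
  set e := ∑ b, w b * g b with he
  have hB : ∀ b, |g b - e| ≤ B := by
    intro b
    have : g b - e = ∑ c, w c * (g b - g c) := by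
      simp [mul_sub, Finset.sum_sub_distrib, ← Finset.sum_mul, hw1, he]
    rw [this]
    refine (Finset.abs_sum_le_sum_abs _ _).trans ?_
    calc _ ≤ ∑ c, w c * B := Finset.sum_le_sum fun c _ => by
            rw [abs_mul, abs_of_nonneg (hw c)]
            exact mul_le_mul_of_nonneg_left (hg b c) (hw c)
      _ = B := by rw [← Finset.sum_mul, hw1, one_mul]
  have hmean : ∑ b, w b * (g b - e) = 0 := by
    simp [mul_sub, Finset.sum_sub_distrib, ← Finset.sum_mul, hw1, he]
  -- On [-lB, lB] the exponential lies below its chord. The slope of the chord disappears on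
  -- averaging, by `hmean`.
  have key : ∃ K : ℝ, ∀ b, Real.exp (l * (g b - e)) ≤ Real.cosh (l * B) + K * (g b - e) := by
    rcases isEmpty_or_nonempty α with h | ⟨⟨b0⟩⟩
    · exact ⟨0, fun b => (h.false b).elim⟩
    rcases ((abs_nonneg _).trans (hB b0)).eq_or_lt with h0 | hpos
    · refine ⟨0, fun b => ?_⟩
      have := hB b
      rw [← h0] at this
      rw [abs_nonpos_iff.1 this, ← h0]; simp
    · refine ⟨Real.sinh (l * B) / B, fun b => ?_⟩
      have h1 := abs_le.1 (hB b)
      have hc := convexOn_exp.2 (Set.mem_univ (l * B)) (Set.mem_univ (-(l * B)))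
        (show 0 ≤ (B + (g b - e)) / (2 * B) from div_nonneg (by linarith) (by linarith))
        (show 0 ≤ (B - (g b - e)) / (2 * B) from div_nonneg (by linarith) (by linarith))
        (by field_simp; ring)
      simp only [smul_eq_mul] at hc
      have e1 : (B + (g b - e)) / (2 * B) * (l * B) + (B - (g b - e)) / (2 * B) * -(l * B)
          = l * (g b - e) := by field_simp; ring
      rw [e1] at hc
      refine hc.trans (le_of_eq ?_)
      rw [Real.cosh_eq, Real.sinh_eq]
      field_simp; ring
  obtain ⟨K, hK⟩ := key
  have : ∑ b, w b * Real.exp (l * (g b - e)) ≤ Real.exp (l ^ 2 * B ^ 2 / 2) := by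
    calc _ ≤ ∑ b, w b * (Real.cosh (l * B) + K * (g b - e)) :=
          Finset.sum_le_sum fun b _ => mul_le_mul_of_nonneg_left (hK b) (hw b)
      _ = Real.cosh (l * B) + K * ∑ b, w b * (g b - e) := by
          simp only [mul_add, Finset.sum_add_distrib, ← Finset.sum_mul, hw1, one_mul,
            Finset.mul_sum]
          congr 1
          exact Finset.sum_congr rfl fun b _ => by ring
      _ ≤ _ := by
          rw [hmean, mul_zero, add_zero, ← mul_pow]
          exact Real.cosh_le_exp_half_sq _
  calc ∑ b, w b * Real.exp (l * g b)
      = Real.exp (l * e) * ∑ b, w b * Real.exp (l * (g b - e)) := by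
        rw [Finset.mul_sum]
        refine Finset.sum_congr rfl fun b _ => ?_
        rw [mul_left_comm, ← Real.exp_add]; congr 2; ring
    _ ≤ _ := mul_le_mul_of_nonneg_left this (Real.exp_pos _).le

theorem abs_prodExp_le (hw : ∀ b, 0 ≤ w b) (hw1 : ∑ b, w b = 1) {F : (Fin n → α) → ℝ} {D : ℝ}
    (h : ∀ a, |F a| ≤ D) : |prodExp w F| ≤ D := by
  have h1 := prodExp_mono (n := n) hw (fun a => (abs_le.1 (h a)).2)
  have h2 := prodExp_mono (n := n) hw (fun a => (abs_le.1 (h a)).1)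
  rw [prodExp_const hw1] at h1 h2
  exact abs_le.2 ⟨h2, h1⟩

/-- The exponential moment form of the bounded differences inequality. -/
theorem prodExp_exp_le (hw : ∀ b, 0 ≤ w b) (hw1 : ∑ b, w b = 1) {F : (Fin n → α) → ℝ} {B : ℝ}
    (hF : ∀ a i b, |F (Function.update a i b) - F a| ≤ B) (l : ℝ) :
    prodExp w (fun a => Real.exp (l * F a)) ≤
      Real.exp (l * prodExp w F) * Real.exp (n * (l ^ 2 * B ^ 2 / 2)) := by
  induction n with
  | zero => simp [prodExp_zero]
  | succ n ih =>
    rw [prodExp_succ, prodExp_succ w F]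
    have h1 : ∀ b, prodExp w (fun a => Real.exp (l * F (Fin.cons b a))) ≤
        Real.exp (l * prodExp w (fun a => F (Fin.cons b a))) *
          Real.exp (n * (l ^ 2 * B ^ 2 / 2)) := by
      intro b
      refine ih (F := fun a => F (Fin.cons b a)) fun a i c => ?_
      simpa [Fin.cons_update] using hF (Fin.cons b a) i.succ c
    have h2 : ∀ b c, |prodExp w (fun a : Fin n → α => F (Fin.cons b a)) -
        prodExp w (fun a : Fin n → α => F (Fin.cons c a))| ≤ B := by
      intro b c
      rw [← prodExp_sub]
      refine abs_prodExp_le hw hw1 fun a => ?_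
      simpa using hF (Fin.cons c a) 0 b
    calc _ ≤ ∑ b, w b * (Real.exp (l * prodExp w (fun a => F (Fin.cons b a))) *
          Real.exp (n * (l ^ 2 * B ^ 2 / 2))) :=
          Finset.sum_le_sum fun b _ => mul_le_mul_of_nonneg_left (h1 b) (hw b)
      _ = (∑ b, w b * Real.exp (l * prodExp w (fun a => F (Fin.cons b a)))) *
          Real.exp (n * (l ^ 2 * B ^ 2 / 2)) := by simp [Finset.sum_mul, mul_assoc]
      _ ≤ _ := mul_le_mul_of_nonneg_right (sum_mul_exp_le hw hw1 h2 l) (Real.exp_pos _).le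
      _ = _ := by
          rw [mul_assoc, ← Real.exp_add]
          congr 2
          push_cast; ring

/-- The expectations of a function under two product laws are close if the functions of each
coordinate have close expectations. -/
theorem abs_prodExp_sub_prodExp_le {u : α → ℝ} (hw : ∀ b, 0 ≤ w b) (hw1 : ∑ b, w b = 1)
    (hu : ∀ b, 0 ≤ u b) (hu1 : ∑ b, u b = 1) {F : (Fin n → α) → ℝ} {D : ℝ}
    (hF : ∀ a i, |∑ b, w b * F (Function.update a i b) - ∑ b, u b * F (Function.update a i b)|
      ≤ D) :
    |prodExp w F - prodExp u F| ≤ n * D := by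
  induction n with
  | zero => simp [prodExp_zero]
  | succ n ih =>
    rw [prodExp_succ, prodExp_succ]
    have h1 : ∀ b, |prodExp w (fun a => F (Fin.cons b a)) -
        prodExp u (fun a => F (Fin.cons b a))| ≤ n * D := by
      intro b
      refine ih (F := fun a => F (Fin.cons b a)) fun a i => ?_
      simpa [Fin.cons_update] using hF (Fin.cons b a) i.succ
    have h2 : |∑ b, w b * prodExp u (fun a => F (Fin.cons b a)) -
        ∑ b, u b * prodExp u (fun a => F (Fin.cons b a))| ≤ D := by
      simp only [← prodExp_const_mul]
      rw [← prodExp_finset_sum, ← prodExp_finset_sum, ← prodExp_sub]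
      refine abs_prodExp_le hu hu1 fun a => ?_
      rcases isEmpty_or_nonempty α with h | ⟨⟨c⟩⟩
      · simp at hw1
      simpa using hF (Fin.cons c a) 0
    have h3 : |∑ b, w b * (prodExp w (fun a => F (Fin.cons b a)) -
        prodExp u (fun a => F (Fin.cons b a)))| ≤ n * D := by
      refine (Finset.abs_sum_le_sum_abs _ _).trans ?_
      calc _ ≤ ∑ c, w c * (n * D) := Finset.sum_le_sum fun c _ => by
              rw [abs_mul, abs_of_nonneg (hw c)]
              exact mul_le_mul_of_nonneg_left (h1 c) (hw c)
        _ = n * D := by rw [← Finset.sum_mul, hw1, one_mul]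
    simp only [mul_sub, Finset.sum_sub_distrib] at h3
    push_cast
    rw [abs_le] at *
    constructor <;> nlinarith

/-- The probability of `S` when the coordinates are independent with common weights `w`. -/
noncomputable def prodProb {α : Type*} [Fintype α] {n : ℕ} (w : α → ℝ)
    (S : Set (Fin n → α)) : ℝ :=
  prodExp w (S.indicator 1)

theorem prodProb_nonneg (hw : ∀ b, 0 ≤ w b) (S : Set (Fin n → α)) : 0 ≤ prodProb w S :=
  prodExp_nonneg hw fun a => Set.indicator_nonneg (by simp) a

theorem prodProb_mono (hw : ∀ b, 0 ≤ w b) {S T : Set (Fin n → α)} (h : S ⊆ T) :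
    prodProb w S ≤ prodProb w T :=
  prodExp_mono hw fun a => Set.indicator_le_indicator_of_subset h (by simp) a

theorem prodProb_union_le (hw : ∀ b, 0 ≤ w b) (S T : Set (Fin n → α)) :
    prodProb w (S ∪ T) ≤ prodProb w S + prodProb w T := by
  unfold prodProb
  rw [← prodExp_add]
  refine prodExp_mono hw fun a => ?_
  by_cases h1 : a ∈ S <;> by_cases h2 : a ∈ T <;> simp [h1, h2]

theorem prodProb_iUnion_le {ι : Type*} [Fintype ι] (hw : ∀ b, 0 ≤ w b)
    (S : ι → Set (Fin n → α)) : prodProb w (⋃ i, S i) ≤ ∑ i, prodProb w (S i) := by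
  unfold prodProb
  rw [← prodExp_finset_sum]
  refine prodExp_mono hw fun a => ?_
  by_cases h : a ∈ ⋃ i, S i
  · obtain ⟨i, hi⟩ := Set.mem_iUnion.1 h
    rw [Set.indicator_of_mem h]
    have h1 : (S i).indicator (1 : (Fin n → α) → ℝ) a = 1 := by simp [hi]
    calc _ = (S i).indicator (1 : (Fin n → α) → ℝ) a := by simp [hi]
      _ ≤ _ := Finset.single_le_sum (f := fun i => (S i).indicator (1 : (Fin n → α) → ℝ) a)
          (fun i _ => Set.indicator_nonneg (by simp) a) (Finset.mem_univ i)
  · rw [Set.indicator_of_notMem h]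
    exact Finset.sum_nonneg fun i _ => Set.indicator_nonneg (by simp) a

/-- The probability of an event is at most its largest conditional probability given all the
coordinates but one. -/
theorem prodProb_le_of_resample (hw : ∀ b, 0 ≤ w b) (hw1 : ∑ b, w b = 1) (i : Fin n)
    {S : Set (Fin n → α)} {β : ℝ}
    (h : ∀ a, ∑ b, w b * S.indicator 1 (Function.update a i b) ≤ β) : prodProb w S ≤ β := by
  unfold prodProb
  rw [← prodExp_resample hw1 i]
  exact (prodExp_mono hw h).trans (prodExp_const hw1 β).le

/-- Markov's inequality for exponential moments. -/
theorem prodProb_le_exp (hw : ∀ b, 0 ≤ w b) (F : (Fin n → α) → ℝ) (t : ℝ) :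
    prodProb w {a | t ≤ F a} ≤ Real.exp (-t) * prodExp w (fun a => Real.exp (F a)) := by
  unfold prodProb
  rw [← prodExp_const_mul]
  refine prodExp_mono hw fun a => ?_
  by_cases h : t ≤ F a
  · rw [Set.indicator_of_mem (by exact h), ← Real.exp_add]
    simpa using h
  · rw [Set.indicator_of_notMem (by exact h)]
    positivity

/-- McDiarmid's bounded differences inequality, with a constant that is not the best one. -/
theorem prodProb_abs_sub_ge_le (hw : ∀ b, 0 ≤ w b) (hw1 : ∑ b, w b = 1) {F : (Fin n → α) → ℝ}
    {B t : ℝ} (hn : 0 < n) (hB : 0 < B) (ht : 0 ≤ t)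
    (hF : ∀ a i b, |F (Function.update a i b) - F a| ≤ B) :
    prodProb w {a | t ≤ |F a - prodExp w F|} ≤ 2 * Real.exp (-(t ^ 2 / (2 * n * B ^ 2))) := by
  have hn' : (0 : ℝ) < n := by exact_mod_cast hn
  -- This value minimizes the exponent -lt + n l² B²/2; the sign s = ±1 below treats the two tails
  -- together.
  set l := t / (n * B ^ 2) with hl
  have key : ∀ s : ℝ, s ^ 2 = 1 → prodProb w {a | l * t ≤ l * (s * (F a - prodExp w F))} ≤
      Real.exp (-(t ^ 2 / (2 * n * B ^ 2))) := by
    intro s hs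
    refine (prodProb_le_exp hw _ _).trans ?_
    have h := prodExp_exp_le hw hw1 hF (l * s)
    have e1 : prodExp w (fun a => Real.exp (l * (s * (F a - prodExp w F)))) =
        Real.exp (-(l * s * prodExp w F)) * prodExp w (fun a => Real.exp (l * s * F a)) := by
      rw [← prodExp_const_mul]
      congr 1; ext a
      rw [← Real.exp_add]; congr 1; ring
    rw [e1]
    calc _ ≤ Real.exp (-(l * t)) * (Real.exp (-(l * s * prodExp w F)) *
          (Real.exp (l * s * prodExp w F) * Real.exp (n * ((l * s) ^ 2 * B ^ 2 / 2)))) := by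
          gcongr
      _ = _ := by
        rw [← Real.exp_add, ← Real.exp_add, ← Real.exp_add]
        congr 1
        rw [mul_pow, hs, hl]
        field_simp
        ring
  have hl0 : 0 ≤ l := by positivity
  have hsub : {a | t ≤ |F a - prodExp w F|} ⊆ {a | l * t ≤ l * (1 * (F a - prodExp w F))} ∪
      {a | l * t ≤ l * (-1 * (F a - prodExp w F))} := by
    intro a ha
    rcases le_abs.1 (show t ≤ |F a - prodExp w F| from ha) with h | h
    · exact Or.inl (mul_le_mul_of_nonneg_left (by linarith) hl0)
    · exact Or.inr (mul_le_mul_of_nonneg_left (by linarith) hl0)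
  refine (prodProb_mono hw hsub).trans ((prodProb_union_le hw _ _).trans ?_)
  rw [two_mul]
  exact add_le_add (key 1 (by norm_num)) (key (-1) (by norm_num))

end prodExp

/-! ### Talagrand's convex distance inequality on the biased cube -/

/-- The sign coded by a Boolean: `true` is `1` and `false` is `-1`. -/
def boolSign (b : Bool) : ℤ := if b then 1 else -1

theorem sum_bool_eq (f : Bool → ℝ) (β : Bool) : ∑ b, f b = f β + f (!β) := by
  cases β <;> simp [add_comm]

/-- The numerical core of Talagrand's induction, with l the log-ratio of the probabilities of the
two sections. The exponent is minimal at t = 1 - 2l, which is admissible for l ≤ 1/2; beyond that t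
= 0 suffices. -/
theorem exists_exp_interpolation_le {l : ℝ} (hl : 0 ≤ l) :
    ∃ t : ℝ, 0 ≤ t ∧ t ≤ 1 ∧ Real.exp ((1 - t) ^ 2 / 4 + t * l) ≤ 2 - Real.exp (-l) := by
  have hneg : ∀ x : ℝ, 0 ≤ x → x ≤ 1 → Real.exp (-x) ≤ 1 - x + x ^ 2 / 2 := by
    intro x hx hx1
    have h1 := Real.quadratic_le_exp_of_nonneg hx
    have h2 : Real.exp (-x) * Real.exp x = 1 := by rw [← Real.exp_add]; simp
    have h3 := Real.exp_pos (-x)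
    have h4 : Real.exp (-x) * (1 + x + x ^ 2 / 2) ≤ 1 := by nlinarith
    have h5 : (0 : ℝ) < 1 + x + x ^ 2 / 2 := by positivity
    rw [← le_div_iff₀ h5] at h4
    refine h4.trans ?_
    rw [div_le_iff₀ h5]
    nlinarith [sq_nonneg (x ^ 2)]
  rcases le_total l (1 / 2) with h | h
  · refine ⟨1 - 2 * l, by linarith, by linarith, ?_⟩
    have e1 : (1 - (1 - 2 * l)) ^ 2 / 4 + (1 - 2 * l) * l = l - l ^ 2 := by ring
    rw [e1]
    set y := l - l ^ 2 with hy
    have hy0 : 0 ≤ y := by nlinarith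
    have hy1 : y ≤ 1 / 4 := by nlinarith [sq_nonneg (l - 1 / 2)]
    have hb := Real.exp_bound' hy0 (by linarith) (n := 3) (by norm_num)
    simp [Finset.sum_range_succ, Nat.factorial] at hb
    have h3 := hneg l hl (by linarith)
    have : Real.exp y ≤ 1 + y + y ^ 2 / 2 + y ^ 3 / 4 := by nlinarith [pow_nonneg hy0 3]
    have hyl : y ≤ l := by nlinarith
    have h4 : y ^ 3 ≤ l ^ 3 := pow_le_pow_left₀ hy0 hyl 3
    have h5 : y ^ 2 = l ^ 2 - 2 * l ^ 3 + l ^ 4 := by rw [hy]; ring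
    have h6 : l ^ 4 ≤ l ^ 3 / 2 := by nlinarith [pow_nonneg hl 3]
    nlinarith [pow_nonneg hl 3]
  · refine ⟨0, le_rfl, zero_le_one, ?_⟩
    have h1 := hneg (1 / 2) (by norm_num) (by norm_num)
    have h2 : Real.exp (-l) ≤ Real.exp (-(1 / 2)) := Real.exp_le_exp.2 (by linarith)
    have h3 := Real.exp_bound' (x := 1 / 4) (by norm_num) (by norm_num) (n := 2) (by norm_num)
    simp [Finset.sum_range_succ, Nat.factorial] at h3
    norm_num at h1 h3 ⊢
    linarith

/-- Hölder's inequality for exponentials. -/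
theorem prodExp_exp_add_le {α : Type*} [Fintype α] {n : ℕ} {w : α → ℝ} (hw : ∀ b, 0 ≤ w b)
    {F G : (Fin n → α) → ℝ} {a b s t : ℝ} (hs : 0 ≤ s) (ht : 0 ≤ t) (hst : s + t = 1)
    (hF : prodExp w (fun x => Real.exp (F x)) ≤ Real.exp a)
    (hG : prodExp w (fun x => Real.exp (G x)) ≤ Real.exp b) :
    prodExp w (fun x => Real.exp (s * F x + t * G x)) ≤ Real.exp (s * a + t * b) := by
  have h : ∀ x, Real.exp (s * F x + t * G x) ≤ Real.exp (s * a + t * b) *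
      (s * (Real.exp (-a) * Real.exp (F x)) + t * (Real.exp (-b) * Real.exp (G x))) := by
    intro x
    have hc := convexOn_exp.2 (Set.mem_univ (F x - a)) (Set.mem_univ (G x - b)) hs ht hst
    simp only [smul_eq_mul] at hc
    rw [← Real.exp_add, ← Real.exp_add, neg_add_eq_sub, neg_add_eq_sub]
    calc _ = Real.exp (s * a + t * b) * Real.exp (s * (F x - a) + t * (G x - b)) := by
          rw [← Real.exp_add]; congr 1; ring
      _ ≤ _ := by gcongr
  refine (prodExp_mono hw h).trans ?_
  rw [prodExp_const_mul, prodExp_add, prodExp_const_mul, prodExp_const_mul, prodExp_const_mul,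
    prodExp_const_mul]
  have h1 : Real.exp (-a) * prodExp w (fun x => Real.exp (F x)) ≤ 1 := by
    calc _ ≤ Real.exp (-a) * Real.exp a := by gcongr
      _ = 1 := by rw [← Real.exp_add]; simp
  have h2 : Real.exp (-b) * prodExp w (fun x => Real.exp (G x)) ≤ 1 := by
    calc _ ≤ Real.exp (-b) * Real.exp b := by gcongr
      _ = 1 := by rw [← Real.exp_add]; simp
  have h3 := Real.exp_pos (s * a + t * b)
  have : s * (Real.exp (-a) * prodExp w (fun x => Real.exp (F x))) +
      t * (Real.exp (-b) * prodExp w (fun x => Real.exp (G x))) ≤ 1 := by nlinarith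
  nlinarith

/-- Allows the nearest points in the two sections of a convex set to be chosen independently. -/
theorem le_add_iInf_add_iInf {ι κ : Type*} [Nonempty ι] [Nonempty κ] {F : ι → ℝ} {G : κ → ℝ}
    {h c s t : ℝ} (hs : 0 ≤ s) (ht : 0 ≤ t) (H : ∀ i j, h ≤ c + s * F i + t * G j) :
    h ≤ c + s * (⨅ i, F i) + t * (⨅ j, G j) := by
  rw [Real.mul_iInf_of_nonneg hs, Real.mul_iInf_of_nonneg ht]
  have h1 : ∀ j, h - c - t * G j ≤ ⨅ i, s * F i := fun j =>
    le_ciInf fun i => by linarith [H i j]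
  have h2 : h - c - (⨅ i, s * F i) ≤ ⨅ j, t * G j := le_ciInf fun j => by linarith [h1 j]
  linarith

/-- The squared Euclidean distance of a sign vector to a set. -/
noncomputable def signDistSq {n : ℕ} (A : Set (Fin n → ℝ)) (x : Fin n → Bool) : ℝ :=
  ⨅ y : A, ∑ j, ((boolSign (x j) : ℝ) - y.1 j) ^ 2

theorem signDistSq_le {n : ℕ} {A : Set (Fin n → ℝ)} (x : Fin n → Bool) {y : Fin n → ℝ}
    (hy : y ∈ A) : signDistSq A x ≤ ∑ j, ((boolSign (x j) : ℝ) - y j) ^ 2 :=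
  ciInf_le (f := fun y : A => ∑ j, ((boolSign (x j) : ℝ) - y.1 j) ^ 2)
    ⟨0, by rintro _ ⟨z, rfl⟩; exact Finset.sum_nonneg fun j _ => sq_nonneg _⟩ ⟨y, hy⟩

/-- Talagrand's inequality for the distance to a convex set in a biased discrete cube. -/
theorem talagrand_convex {n : ℕ} {w : Bool → ℝ} (hw : ∀ b, 0 ≤ w b) (hw1 : ∑ b, w b = 1)
    {A : Set (Fin n → ℝ)} (hA : Convex ℝ A) {h : (Fin n → Bool) → ℝ}
    (hh : ∀ x, ∀ y ∈ A, h x ≤ ∑ j, ((boolSign (x j) : ℝ) - y j) ^ 2) :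
    prodExp w (fun x => Real.exp (h x / 16)) *
      prodProb w {x | (fun j => (boolSign (x j) : ℝ)) ∈ A} ≤ 1 := by
  induction n with
  | zero =>
    unfold prodProb
    rw [prodExp_zero, prodExp_zero]
    by_cases hm : (fun j => (boolSign (Fin.elim0 j : Bool) : ℝ)) ∈ A
    · have h0 := hh Fin.elim0 _ hm
      simp only [Finset.univ_eq_empty, Finset.sum_empty] at h0
      rw [Set.indicator_of_mem (by exact hm)]
      have h1 : h Fin.elim0 / 16 ≤ 0 := div_nonpos_of_nonpos_of_nonneg h0 (by norm_num)
      simpa using h1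
    · rw [Set.indicator_of_notMem (by exact hm)]
      simp
  | succ n ih =>
    set S : Bool → Set (Fin n → ℝ) := fun b => {y | (Fin.cons (boolSign b : ℝ) y : Fin (n + 1) → ℝ) ∈ A}
      with hS
    have hSc : ∀ b, Convex ℝ (S b) := by
      intro b y hy z hz s t hs ht hst
      have := hA hy hz hs ht hst
      change (Fin.cons (boolSign b : ℝ) (s • y + t • z) : Fin (n + 1) → ℝ) ∈ A
      convert this using 1
      ext j
      refine Fin.cases ?_ (fun i => ?_) j
      · simp only [Fin.cons_zero, Pi.add_apply, Pi.smul_apply, smul_eq_mul]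
        rw [← add_mul, hst, one_mul]
      · simp
    set P : Bool → ℝ := fun b => prodProb w {x | (fun j => (boolSign (x j) : ℝ)) ∈ S b} with hP
    have hP0 : ∀ b, 0 ≤ P b := fun b => prodProb_nonneg hw _
    have hPA : prodProb w {x : Fin (n + 1) → Bool | (fun j => (boolSign (x j) : ℝ)) ∈ A} =
        ∑ b, w b * P b := by
      unfold prodProb
      rw [prodExp_succ]
      refine Finset.sum_congr rfl fun b _ => ?_
      congr 1
      simp only [hP, prodProb]
      congr 1
      ext x
      have : (fun j => (boolSign ((Fin.cons b x : Fin (n + 1) → Bool) j) : ℝ)) =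
          (Fin.cons (boolSign b : ℝ) (fun j => (boolSign (x j) : ℝ)) : Fin (n + 1) → ℝ) := by
        ext j
        refine Fin.cases ?_ (fun i => ?_) j <;> simp
      have hiff : (Fin.cons b x : Fin (n + 1) → Bool) ∈
          {x : Fin (n + 1) → Bool | (fun j => (boolSign (x j) : ℝ)) ∈ A} ↔
          x ∈ {x : Fin n → Bool | (fun j => (boolSign (x j) : ℝ)) ∈ S b} := by
        change (fun j => (boolSign ((Fin.cons b x : Fin (n + 1) → Bool) j) : ℝ)) ∈ A ↔
          (Fin.cons (boolSign b : ℝ) (fun j => (boolSign (x j) : ℝ)) : Fin (n + 1) → ℝ) ∈ A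
        rw [this]
      by_cases hx : x ∈ {x : Fin n → Bool | (fun j => (boolSign (x j) : ℝ)) ∈ S b}
      · rw [Set.indicator_of_mem hx, Set.indicator_of_mem (hiff.2 hx)]; rfl
      · rw [Set.indicator_of_notMem hx, Set.indicator_of_notMem (fun h => hx (hiff.1 h))]
    have hne : ∀ b, 0 < P b → (S b).Nonempty := by
      intro b hb
      by_contra hcon
      rw [Set.not_nonempty_iff_eq_empty] at hcon
      simp [hP, hcon, prodProb, prodExp] at hb
    have hHb : ∀ b, 0 < P b →
        prodExp w (fun x => Real.exp (signDistSq (S b) x / 16)) ≤ Real.exp (-Real.log (P b)) := by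
      intro b hb
      rw [Real.exp_neg, Real.exp_log hb, ← one_div, le_div_iff₀ hb]
      exact ih (hSc b) fun x y hy => signDistSq_le x hy
    -- β is the sign of the more likely section. A point with the other sign may use either section;
    -- crossing over costs squared distance 4, hence 1/4 after division by 16.
    obtain ⟨β, hβ⟩ : ∃ β, P (!β) ≤ P β := by
      rcases le_total (P true) (P false) with h | h
      · exact ⟨false, h⟩
      · exact ⟨true, h⟩
    rw [hPA, prodExp_succ, sum_bool_eq _ β, sum_bool_eq _ β]
    rw [sum_bool_eq _ β] at hw1
    rcases (hP0 β).eq_or_lt with hu | hu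
    · have : P (!β) = 0 := le_antisymm (hu ▸ hβ) (hP0 _)
      simp [← hu, this]
    have hsum : ∀ b c x, ∀ y : Fin n → ℝ, ∑ j, ((boolSign ((Fin.cons b x : Fin (n + 1) → Bool) j) : ℝ)
        - (Fin.cons (c : ℝ) y : Fin (n + 1) → ℝ) j) ^ 2 =
        ((boolSign b : ℝ) - c) ^ 2 + ∑ j, ((boolSign (x j) : ℝ) - y j) ^ 2 := by
      intro b c x y
      rw [Fin.sum_univ_succ]; simp
    have hsgn : ((boolSign (!β) : ℝ) - boolSign β) ^ 2 = 4 := by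
      cases β <;> norm_num [boolSign]
    have h1 : prodExp w (fun x => Real.exp (h (Fin.cons β x) / 16)) ≤ 1 / P β := by
      rw [one_div, ← Real.exp_log hu, ← Real.exp_neg]
      refine (prodExp_mono hw fun x => ?_).trans (hHb β hu)
      have : Nonempty (S β) := (hne β hu).to_subtype
      refine Real.exp_le_exp.2 (div_le_div_of_nonneg_right (le_ciInf fun y => ?_) (by norm_num))
      have := hh (Fin.cons β x) _ y.2
      rw [hsum] at this
      simpa using this
    have h2 : prodExp w (fun x => Real.exp (h (Fin.cons (!β) x) / 16)) ≤
        1 / P β * (2 - P (!β) / P β) := by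
      have hSβ : Nonempty (S β) := (hne β hu).to_subtype
      rcases (hP0 (!β)).eq_or_lt with hv | hv
      -- The smaller section may be empty here, so only the larger one is used, at the price
      -- exp(1/4) ≤ 2.
      · rw [← hv, zero_div, sub_zero]
        have hx : ∀ x, Real.exp (h (Fin.cons (!β) x) / 16) ≤
            Real.exp (1 / 4) * Real.exp (signDistSq (S β) x / 16) := by
          intro x
          rw [← Real.exp_add]
          refine Real.exp_le_exp.2 ?_
          have : h (Fin.cons (!β) x) - 4 ≤ signDistSq (S β) x := by
            refine le_ciInf fun y => ?_
            have := hh (Fin.cons (!β) x) _ y.2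
            rw [hsum, hsgn] at this
            linarith
          linarith
        refine (prodExp_mono hw hx).trans ?_
        rw [prodExp_const_mul, mul_comm]
        have h3 := hHb β hu
        rw [Real.exp_neg, Real.exp_log hu, ← one_div] at h3
        have h4 : Real.exp (1 / 4) ≤ 2 := by
          have := Real.exp_bound' (x := 1 / 4) (by norm_num) (by norm_num) (n := 2) (by norm_num)
          simp [Finset.sum_range_succ, Nat.factorial] at this
          norm_num at this ⊢
          linarith
        exact mul_le_mul h3 h4 (Real.exp_pos _).le (by positivity)
      · have hSβ' : Nonempty (S (!β)) := (hne _ hv).to_subtype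
        have hlog : Real.log (P (!β)) ≤ Real.log (P β) := Real.log_le_log hv hβ
        obtain ⟨t, ht0, ht1, ht⟩ :=
          exists_exp_interpolation_le (l := Real.log (P β) - Real.log (P (!β))) (by linarith)
        -- Mixing points of the two sections with weights 1 - t and t stays in A by convexity. The
        -- first coordinate then contributes 4(1 - t)², the others at most the mixture of the two
        -- squared distances; Hölder's inequality separates the latter.
        have hx : ∀ x, Real.exp (h (Fin.cons (!β) x) / 16) ≤ Real.exp ((1 - t) ^ 2 / 4) *
            Real.exp ((1 - t) * (signDistSq (S β) x / 16) + t * (signDistSq (S (!β)) x / 16)) := by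
          intro x
          rw [← Real.exp_add]
          refine Real.exp_le_exp.2 ?_
          have : h (Fin.cons (!β) x) ≤ 4 * (1 - t) ^ 2 + (1 - t) * signDistSq (S β) x +
              t * signDistSq (S (!β)) x := by
            refine le_add_iInf_add_iInf (by linarith) ht0 fun y z => ?_
            have hyz := hA y.2 z.2 (show 0 ≤ 1 - t by linarith) ht0 (by ring)
            have hcons : (1 - t) • (Fin.cons (boolSign β : ℝ) y.1 : Fin (n + 1) → ℝ) +
                t • (Fin.cons (boolSign (!β) : ℝ) z.1 : Fin (n + 1) → ℝ) =
                Fin.cons ((1 - t) * boolSign β + t * boolSign (!β)) ((1 - t) • y.1 + t • z.1) := by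
              ext j
              refine Fin.cases ?_ (fun i => ?_) j <;> simp
            rw [hcons] at hyz
            have := hh (Fin.cons (!β) x) _ hyz
            rw [hsum] at this
            have e1 : ((boolSign (!β) : ℝ) - ((1 - t) * boolSign β + t * boolSign (!β))) ^ 2 =
                4 * (1 - t) ^ 2 := by rw [← hsgn]; ring
            rw [e1] at this
            refine this.trans ?_
            rw [add_assoc, Finset.mul_sum, Finset.mul_sum, ← Finset.sum_add_distrib]
            refine add_le_add le_rfl (Finset.sum_le_sum fun j _ => ?_)
            simp only [Pi.add_apply, Pi.smul_apply, smul_eq_mul]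
            nlinarith [mul_nonneg (mul_nonneg ht0 (show 0 ≤ 1 - t by linarith))
              (sq_nonneg (y.1 j - z.1 j))]
          linarith
        refine (prodExp_mono hw hx).trans ?_
        rw [prodExp_const_mul]
        have h3 := prodExp_exp_add_le hw (show 0 ≤ 1 - t by linarith) ht0 (by ring)
          (hHb β hu) (hHb (!β) hv)
        calc _ ≤ Real.exp ((1 - t) ^ 2 / 4) *
              Real.exp ((1 - t) * -Real.log (P β) + t * -Real.log (P (!β))) := by gcongr
          _ = Real.exp (-Real.log (P β)) * Real.exp ((1 - t) ^ 2 / 4 +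
                t * (Real.log (P β) - Real.log (P (!β)))) := by
              rw [← Real.exp_add, ← Real.exp_add]; congr 1; ring
          _ ≤ Real.exp (-Real.log (P β)) *
                (2 - Real.exp (-(Real.log (P β) - Real.log (P (!β))))) := by gcongr
          _ = _ := by
              rw [neg_sub, Real.exp_sub, Real.exp_neg, Real.exp_log hu, Real.exp_log hv, one_div]
    have hwβ := hw β
    have hwβ' := hw (!β)
    have hr0 : 0 ≤ P (!β) / P β := div_nonneg (hP0 _) hu.le
    have hr : P (!β) = P (!β) / P β * P β := by field_simp
    have hPsum : 0 ≤ w β * P β + w (!β) * P (!β) :=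
      add_nonneg (mul_nonneg hwβ (hP0 _)) (mul_nonneg hwβ' (hP0 _))
    calc _ ≤ (w β * (1 / P β) + w (!β) * (1 / P β * (2 - P (!β) / P β))) *
          (w β * P β + w (!β) * P (!β)) := by gcongr
      _ = (w β + w (!β) * (2 - P (!β) / P β)) * (w β + w (!β) * (P (!β) / P β)) := by
          field_simp
      -- With r the ratio of the section probabilities and u = w(!β)(1 - r), the product is (1 +
      -- u)(1 - u).
      _ ≤ 1 := by
          have : w β = 1 - w (!β) := by linarith
          rw [this]
          nlinarith [sq_nonneg (w (!β) * (1 - P (!β) / P β))]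

/-! ### Distance of a random sign vector to a subspace -/

/-- The sign vector coded by `x`, in `ℂⁿ`. -/
noncomputable def signRow {n : ℕ} (x : Fin n → Bool) : EuclideanSpace ℂ (Fin n) :=
  WithLp.toLp 2 fun j => (boolSign (x j) : ℂ)

theorem infDist_eq_norm_starProjection {E : Type*} [NormedAddCommGroup E] [InnerProductSpace ℂ E]
    [FiniteDimensional ℂ E] (V : Submodule ℂ E) (x : E) :
    Metric.infDist x (V : Set E) = ‖Vᗮ.starProjection x‖ := by
  rw [V.starProjection_orthogonal', Metric.infDist_eq_iInf]
  change _ = ‖x - V.starProjection x‖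
  rw [Submodule.starProjection_minimal]
  simp_rw [dist_eq_norm]
  rfl

/-- A second moment dominates the variance, and a biased sign has variance 4 w(true) w(false).
Averaging over one sign leaves its variance plus a new shift, which is why d is generalized in the
induction. -/
theorem le_prodExp_normSq {n : ℕ} {w : Bool → ℝ} (hw1 : ∑ b, w b = 1)
    (c : Fin n → ℂ) (d : ℂ) :
    4 * (w true * w false) * ∑ j, ‖c j‖ ^ 2 ≤
      prodExp w (fun x => ‖∑ j, c j * (boolSign (x j) : ℂ) + d‖ ^ 2) := by
  induction n generalizing d with
  | zero => simp [prodExp_zero]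
  | succ n ih =>
    rw [prodExp_succ, Fintype.sum_bool]
    have hb : w true + w false = 1 := by simpa using hw1
    have e : ∀ b, prodExp w (fun a : Fin n → Bool => ‖∑ j, c j *
        (boolSign ((Fin.cons b a : Fin (n + 1) → Bool) j) : ℂ) + d‖ ^ 2) =
        prodExp w (fun a : Fin n → Bool => ‖(∑ j : Fin n, c j.succ * (boolSign (a j) : ℂ) + d) +
          (boolSign b : ℂ) * c 0‖ ^ 2) := by
      intro b
      congr 1; ext a
      rw [Fin.sum_univ_succ]
      simp only [Fin.cons_zero, Fin.cons_succ]
      congr 2; ring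
    rw [e, e, ← prodExp_const_mul, ← prodExp_const_mul, ← prodExp_add]
    have key : ∀ v : ℂ, w true * ‖v + (boolSign true : ℂ) * c 0‖ ^ 2 +
        w false * ‖v + (boolSign false : ℂ) * c 0‖ ^ 2 =
        4 * (w true * w false) * ‖c 0‖ ^ 2 +
          ‖v + ((w true - w false : ℝ) : ℂ) * c 0‖ ^ 2 := by
      intro v
      have h1 : w true = 1 - w false := by linarith
      simp only [boolSign, Complex.sq_norm, Complex.normSq_apply, h1]
      simp
      ring
    simp_rw [key]
    rw [prodExp_add, prodExp_const hw1, Fin.sum_univ_succ, mul_add]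
    refine add_le_add le_rfl ?_
    refine (ih (fun j => c j.succ) (d + ((w true - w false : ℝ) : ℂ) * c 0)).trans (le_of_eq ?_)
    simp_rw [add_assoc]

/-- The squared distance is a sum over an orthonormal basis of the orthogonal complement, and each
basis vector contributes at least the variance of one sign. -/
theorem le_prodExp_infDist_sq {n : ℕ} {w : Bool → ℝ} (hw1 : ∑ b, w b = 1)
    (V : Submodule ℂ (EuclideanSpace ℂ (Fin n))) (u : EuclideanSpace ℂ (Fin n)) :
    4 * (w true * w false) * (Module.finrank ℂ Vᗮ : ℝ) ≤
      prodExp w (fun x => Metric.infDist (signRow x + u) (V : Set _) ^ 2) := by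
  set b := stdOrthonormalBasis ℂ Vᗮ
  have h : ∀ x : EuclideanSpace ℂ (Fin n), Metric.infDist x (V : Set _) ^ 2 =
      ∑ i, ‖inner ℂ ((b i : EuclideanSpace ℂ (Fin n))) x‖ ^ 2 := by
    intro x
    rw [infDist_eq_norm_starProjection, Submodule.starProjection_apply,
      ← Submodule.coe_norm, ← b.sum_sq_norm_inner_right]
    refine Finset.sum_congr rfl fun i _ => ?_
    rw [Submodule.inner_orthogonalProjectionOnto_eq_of_mem_left]
  simp_rw [h]
  rw [prodExp_finset_sum]
  calc _ = ∑ i : Fin (Module.finrank ℂ Vᗮ), 4 * (w true * w false) := by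
        simp [mul_comm]
    _ ≤ _ := Finset.sum_le_sum fun i _ => ?_
  have h1 := le_prodExp_normSq hw1
    (fun j => star ((b i : EuclideanSpace ℂ (Fin n)) j)) (inner ℂ (b i : EuclideanSpace ℂ (Fin n)) u)
  have h2 : ∑ j, ‖star ((b i : EuclideanSpace ℂ (Fin n)) j)‖ ^ 2 = 1 := by
    have h3 : ‖(b i : EuclideanSpace ℂ (Fin n))‖ = 1 := by
      rw [← Submodule.coe_norm]; exact b.orthonormal.1 i
    simp only [norm_star]
    rw [← EuclideanSpace.norm_sq_eq, h3, one_pow]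
  rw [h2, mul_one] at h1
  refine h1.trans (le_of_eq ?_)
  congr 1; ext x
  rw [inner_add_right]
  congr 3
  simp [PiLp.inner_apply, signRow, mul_comm]

/-- A row of independent biased signs is far from any fixed subspace of large codimension. -/
theorem prodProb_infDist_le {n : ℕ} {w : Bool → ℝ} (hw : ∀ b, 0 ≤ w b) (hw1 : ∑ b, w b = 1)
    (V : Submodule ℂ (EuclideanSpace ℂ (Fin n))) (u : EuclideanSpace ℂ (Fin n)) {a : ℝ} :
    prodProb w {x | Metric.infDist (signRow x + u) (V : Set _) ≤ a} ≤
      Real.exp (-((2 * (w true * w false) * (Module.finrank ℂ Vᗮ : ℝ) - a ^ 2) / 16)) := by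
  set ι : (Fin n → ℝ) → EuclideanSpace ℂ (Fin n) := fun y => WithLp.toLp 2 fun j => (y j : ℂ)
    with hι
  set f : (Fin n → ℝ) → ℝ := fun y => ‖Vᗮ.starProjection (ι y + u)‖ with hf
  have hι_sign : ∀ x : Fin n → Bool, signRow x = ι (fun j => (boolSign (x j) : ℝ)) := by
    intro x
    simp [signRow, hι]
  have hfx : ∀ x : Fin n → Bool, Metric.infDist (signRow x + u) (V : Set _) =
      f (fun j => (boolSign (x j) : ℝ)) := by
    intro x
    rw [infDist_eq_norm_starProjection, hι_sign]
  have hconv : Convex ℝ {y | f y ≤ a} := by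
    intro y hy z hz s t hs ht hst
    have e : ι (s • y + t • z) + u = (s : ℂ) • (ι y + u) + (t : ℂ) • (ι z + u) := by
      have : u = (s : ℂ) • u + (t : ℂ) • u := by
        rw [← add_smul, ← Complex.ofReal_add, hst]; simp
      rw [smul_add, smul_add, add_add_add_comm, ← this]
      congr 1
      ext j
      simp [hι]
    change ‖Vᗮ.starProjection (ι (s • y + t • z) + u)‖ ≤ a
    rw [e, map_add, map_smul, map_smul]
    refine (norm_add_le _ _).trans ?_
    rw [norm_smul, norm_smul, Complex.norm_real, Complex.norm_real, Real.norm_of_nonneg hs,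
      Real.norm_of_nonneg ht]
    have hy' : f y ≤ a := hy
    have hz' : f z ≤ a := hz
    calc _ ≤ s * a + t * a := add_le_add (mul_le_mul_of_nonneg_left hy' hs)
          (mul_le_mul_of_nonneg_left hz' ht)
      _ = a := by rw [← add_mul, hst, one_mul]
  have hlip : ∀ y z, f y ≤ f z + ‖ι y - ι z‖ := by
    intro y z
    have h1 : Vᗮ.starProjection (ι y + u) =
        Vᗮ.starProjection (ι z + u) + Vᗮ.starProjection (ι y - ι z) := by
      rw [← map_add]; congr 1; abel
    change ‖Vᗮ.starProjection (ι y + u)‖ ≤ _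
    rw [h1]
    exact (norm_add_le _ _).trans (add_le_add le_rfl (Submodule.norm_starProjection_apply_le _ _))
  have hdist : ∀ y z, ‖ι y - ι z‖ ^ 2 = ∑ j, (y j - z j) ^ 2 := by
    intro y z
    rw [EuclideanSpace.norm_sq_eq]
    refine Finset.sum_congr rfl fun j _ => ?_
    simp only [hι, PiLp.sub_apply]
    rw [← Complex.ofReal_sub, Complex.norm_real, Real.norm_eq_abs, sq_abs]
  -- If y lies in the sublevel set at distance d from x, then f(x) ≤ a + d, so f(x)² ≤ 2a² + 2d²;
  -- this dictates the choice of h.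
  have hT := talagrand_convex hw hw1 hconv
    (h := fun x => f (fun j => (boolSign (x j) : ℝ)) ^ 2 / 2 - a ^ 2) (by
      intro x y hy
      have h1 := hlip (fun j => (boolSign (x j) : ℝ)) y
      rw [← hdist]
      have hy' : f y ≤ a := hy
      have h0 : 0 ≤ f (fun j => (boolSign (x j) : ℝ)) := norm_nonneg _
      have h2 : 0 ≤ f y := norm_nonneg _
      have h3 := norm_nonneg (ι (fun j => (boolSign (x j) : ℝ)) - ι y)
      set d := ‖ι (fun j => (boolSign (x j) : ℝ)) - ι y‖
      have h4 : f (fun j => (boolSign (x j) : ℝ)) ≤ a + d := by linarith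
      have h5 := mul_self_le_mul_self h0 h4
      nlinarith [sq_nonneg (a - d)])
  have hset : {x : Fin n → Bool | Metric.infDist (signRow x + u) (V : Set _) ≤ a} =
      {x | (fun j => (boolSign (x j) : ℝ)) ∈ {y | f y ≤ a}} := by
    ext x
    change _ ≤ a ↔ f _ ≤ a
    rw [hfx]
  rw [hset]
  set p := prodProb w {x | (fun j => (boolSign (x j) : ℝ)) ∈ {y | f y ≤ a}}
  have hp : 0 ≤ p := prodProb_nonneg hw _
  set m := (2 * (w true * w false) * (Module.finrank ℂ Vᗮ : ℝ) - a ^ 2) / 16 with hm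
  -- Jensen's inequality, through the tangent line of exp at m, which is a lower bound for the mean
  -- of the exponent.
  have hJ : Real.exp m ≤ prodExp w (fun x : Fin n → Bool =>
      Real.exp ((f (fun j => (boolSign (x j) : ℝ)) ^ 2 / 2 - a ^ 2) / 16)) := by
    have h1 : ∀ x : Fin n → Bool, Real.exp m * (1 + (f (fun j => (boolSign (x j) : ℝ)) ^ 2 * (1 / 32)
        - (a ^ 2 / 16 + m))) ≤
        Real.exp ((f (fun j => (boolSign (x j) : ℝ)) ^ 2 / 2 - a ^ 2) / 16) := by
      intro x
      set q := (f (fun j => (boolSign (x j) : ℝ)) ^ 2 / 2 - a ^ 2) / 16 with hq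
      have e1 : 1 + (f (fun j => (boolSign (x j) : ℝ)) ^ 2 * (1 / 32) - (a ^ 2 / 16 + m)) =
          (q - m) + 1 := by rw [hq]; ring
      have e2 : Real.exp q = Real.exp m * Real.exp (q - m) := by
        rw [← Real.exp_add]; congr 1; ring
      rw [e1, e2]
      exact mul_le_mul_of_nonneg_left (Real.add_one_le_exp _) (Real.exp_pos _).le
    refine le_trans ?_ (prodExp_mono hw h1)
    rw [prodExp_const_mul, prodExp_add, prodExp_const hw1, prodExp_sub, prodExp_const hw1]
    have h2 := le_prodExp_infDist_sq hw1 V u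
    simp_rw [hfx] at h2
    have h3 : prodExp w (fun x : Fin n → Bool => f (fun j => (boolSign (x j) : ℝ)) ^ 2 * (1 / 32)) =
        1 / 32 * prodExp w (fun x : Fin n → Bool => f (fun j => (boolSign (x j) : ℝ)) ^ 2) := by
      rw [← prodExp_const_mul]; congr 1; ext x; ring
    rw [h3]
    refine le_mul_of_one_le_right (Real.exp_pos _).le ?_
    rw [hm]
    linarith
  have hfin : Real.exp m * p ≤ 1 := (mul_le_mul_of_nonneg_right hJ hp).trans hT
  rw [Real.exp_neg, ← one_div, le_div_iff₀ (Real.exp_pos _)]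
  linarith

/-! ### Regularized quadratic forms and determinants -/

section Regularization

variable {E : Type*} [NormedAddCommGroup E] [InnerProductSpace ℂ E] {ι : Type*}

/-- The operator `τ + ∑ i ∈ I, r i (r i)*`. -/
noncomputable def regOp (τ : ℝ) (r : ι → E) (I : Finset ι) : E →ₗ[ℂ] E :=
  (τ : ℂ) • LinearMap.id + ∑ i ∈ I, (innerₛₗ ℂ (r i)).smulRight (r i)

theorem regOp_apply (τ : ℝ) (r : ι → E) (I : Finset ι) (y : E) :
    regOp τ r I y = (τ : ℂ) • y + ∑ i ∈ I, inner ℂ (r i) y • r i := by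
  simp [regOp]

theorem inner_regOp_self (τ : ℝ) (r : ι → E) (I : Finset ι) (y : E) :
    inner ℂ (regOp τ r I y) y = ((τ * ‖y‖ ^ 2 + ∑ i ∈ I, ‖inner ℂ (r i) y‖ ^ 2 : ℝ) : ℂ) := by
  rw [regOp_apply, inner_add_left, inner_smul_left, sum_inner, inner_self_eq_norm_sq_to_K]
  push_cast
  congr 1
  · simp
  · refine Finset.sum_congr rfl fun i _ => ?_
    rw [inner_smul_left, ← Complex.conj_mul']

theorem regOp_injective {τ : ℝ} (hτ : 0 < τ) (r : ι → E) (I : Finset ι) :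
    Function.Injective (regOp τ r I) := by
  rw [injective_iff_map_eq_zero]
  intro y hy
  have h := inner_regOp_self τ r I y
  rw [hy, inner_zero_left, eq_comm, Complex.ofReal_eq_zero] at h
  have h2 : 0 ≤ ∑ i ∈ I, ‖inner ℂ (r i) y‖ ^ 2 := Finset.sum_nonneg fun i _ => by positivity
  have h3 : 0 ≤ τ * ‖y‖ ^ 2 := by positivity
  have h4 : τ * ‖y‖ ^ 2 = 0 := by linarith
  simpa [hτ.ne'] using h4

theorem regOp_congr {τ : ℝ} {r r' : ι → E} {I : Finset ι} (h : ∀ i ∈ I, r i = r' i) :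
    regOp τ r I = regOp τ r' I := by
  unfold regOp
  congr 1
  exact Finset.sum_congr rfl fun i hi => by rw [h i hi]

variable [FiniteDimensional ℂ E]

theorem exists_regOp_eq {τ : ℝ} (hτ : 0 < τ) (r : ι → E) (I : Finset ι) (v : E) :
    ∃ y, regOp τ r I y = v :=
  (LinearMap.injective_iff_surjective.1 (regOp_injective hτ r I)) v

open Classical in
/-- The quadratic form `v* (τ + ∑ i ∈ I, r i (r i)*)⁻¹ v`. -/
noncomputable def regForm (τ : ℝ) (r : ι → E) (I : Finset ι) (v : E) : ℝ :=
  -- For τ > 0 the operator is invertible and the default 0 never occurs. The energy of the preimage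
  -- y equals ⟨v, y⟩ and is visibly real and nonnegative.
  if h : ∃ y, regOp τ r I y = v then
    τ * ‖h.choose‖ ^ 2 + ∑ i ∈ I, ‖inner ℂ (r i) h.choose‖ ^ 2 else 0

theorem exists_regForm_eq {τ : ℝ} (hτ : 0 < τ) (r : ι → E) (I : Finset ι) (v : E) :
    ∃ y, regOp τ r I y = v ∧ inner ℂ v y = (regForm τ r I v : ℂ) ∧
      regForm τ r I v = τ * ‖y‖ ^ 2 + ∑ i ∈ I, ‖inner ℂ (r i) y‖ ^ 2 := by
  have h := exists_regOp_eq hτ r I v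
  have h1 : regForm τ r I v =
      τ * ‖h.choose‖ ^ 2 + ∑ i ∈ I, ‖inner ℂ (r i) h.choose‖ ^ 2 := by
    rw [regForm, dif_pos h]
  refine ⟨h.choose, h.choose_spec, ?_, h1⟩
  rw [h1, ← inner_regOp_self, h.choose_spec]

theorem regForm_nonneg {τ : ℝ} (hτ : 0 < τ) (r : ι → E) (I : Finset ι) (v : E) :
    0 ≤ regForm τ r I v := by
  obtain ⟨y, -, -, h⟩ := exists_regForm_eq hτ r I v
  rw [h]
  exact add_nonneg (by positivity) (Finset.sum_nonneg fun i _ => by positivity)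

/-- Half of the variational principle: τ N(v) is the least value of ‖p‖² + τ ∑ |c_i|² over all
decompositions of v. Pairing v with the preimage y and applying AM-GM termwise gives it; the minimum
is at p = τy, c_i = ⟨r_i, y⟩. -/
theorem mul_regForm_le {τ : ℝ} (hτ : 0 < τ) {r : ι → E} {I : Finset ι} {v p : E} {c : ι → ℂ}
    (h : v = p + ∑ i ∈ I, c i • r i) :
    τ * regForm τ r I v ≤ ‖p‖ ^ 2 + τ * ∑ i ∈ I, ‖c i‖ ^ 2 := by
  obtain ⟨y, -, h1, h2⟩ := exists_regForm_eq hτ r I v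
  have h3 : regForm τ r I v ≤ ‖p‖ * ‖y‖ + ∑ i ∈ I, ‖c i‖ * ‖inner ℂ (r i) y‖ := by
    have h4 : ‖inner ℂ v y‖ = regForm τ r I v := by
      rw [h1, Complex.norm_real, Real.norm_of_nonneg (regForm_nonneg hτ r I v)]
    rw [← h4]
    nth_rw 1 [h]
    rw [inner_add_left, sum_inner]
    refine (norm_add_le _ _).trans (add_le_add (norm_inner_le_norm _ _) ?_)
    refine (norm_sum_le _ _).trans (Finset.sum_le_sum fun i _ => ?_)
    rw [inner_smul_left, norm_mul, RCLike.norm_conj]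
  have h5 : 2 * ∑ i ∈ I, ‖c i‖ * ‖inner ℂ (r i) y‖ ≤
      ∑ i ∈ I, ‖c i‖ ^ 2 + ∑ i ∈ I, ‖inner ℂ (r i) y‖ ^ 2 := by
    rw [Finset.mul_sum, ← Finset.sum_add_distrib]
    exact Finset.sum_le_sum fun i _ => by
      nlinarith [sq_nonneg (‖c i‖ - ‖inner ℂ (r i) y‖)]
  have h6 := sq_nonneg (‖p‖ - τ * ‖y‖)
  have h7 := mul_le_mul_of_nonneg_left h3 hτ.le
  have h8 := mul_le_mul_of_nonneg_left h5 hτ.le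
  have h9 : τ * regForm τ r I v = τ * (τ * ‖y‖ ^ 2) + τ * ∑ i ∈ I, ‖inner ℂ (r i) y‖ ^ 2 := by
    rw [h2]; ring
  nlinarith

theorem mul_regForm_le_norm_sq {τ : ℝ} (hτ : 0 < τ) (r : ι → E) (I : Finset ι) (v : E) :
    τ * regForm τ r I v ≤ ‖v‖ ^ 2 := by
  simpa using mul_regForm_le hτ (r := r) (I := I) (v := v) (p := v) (c := 0) (by simp)

/-- If y is the preimage of v, then τy is the difference between v and a vector of the span. -/
theorem infDist_sq_le_mul_regForm {τ : ℝ} (hτ : 0 < τ) (r : ι → E) (I : Finset ι) (v : E) :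
    Metric.infDist v (Submodule.span ℂ (r '' I) : Set E) ^ 2 ≤ τ * regForm τ r I v := by
  obtain ⟨y, h0, -, h2⟩ := exists_regForm_eq hτ r I v
  rw [regOp_apply] at h0
  have hmem : ∑ i ∈ I, inner ℂ (r i) y • r i ∈ Submodule.span ℂ (r '' I) :=
    Submodule.sum_mem _ fun i hi =>
      Submodule.smul_mem _ _ (Submodule.subset_span (Set.mem_image_of_mem r hi))
  have h3 : Metric.infDist v (Submodule.span ℂ (r '' I) : Set E) ≤ τ * ‖y‖ := by
    refine (Metric.infDist_le_dist_of_mem hmem).trans (le_of_eq ?_)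
    rw [dist_eq_norm, ← h0, add_sub_cancel_right, norm_smul, Complex.norm_real,
      Real.norm_of_nonneg hτ.le]
  have h4 := pow_le_pow_left₀ Metric.infDist_nonneg h3 2
  have h5 : 0 ≤ τ * ∑ i ∈ I, ‖inner ℂ (r i) y‖ ^ 2 :=
    mul_nonneg hτ.le (Finset.sum_nonneg fun i _ => by positivity)
  rw [h2]
  nlinarith

/-- Adding v - v' to the residual of the optimal decomposition of v' gives a competitor for v. With
e = ‖v - v'‖/√τ this yields N ≤ N' + 2qe + e², where q² ≤ N'; as 2q ≤ 1 + N', the bound becomes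
multiplicative, with factor 1 + e + e² ≤ exp(2e). -/
theorem log_one_add_regForm_sub_le {τ : ℝ} (hτ : 0 < τ) (r : ι → E) (I : Finset ι) (v v' : E) :
    Real.log (1 + regForm τ r I v) - Real.log (1 + regForm τ r I v') ≤
      2 * (‖v - v'‖ / Real.sqrt τ) := by
  obtain ⟨y, h0, -, h2⟩ := exists_regForm_eq hτ r I v'
  rw [regOp_apply] at h0
  have h3 := mul_regForm_le hτ (r := r) (I := I) (v := v) (p := (τ : ℂ) • y + (v - v'))
    (c := fun i => inner ℂ (r i) y) (by rw [← h0]; abel)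
  set N := regForm τ r I v
  set N' := regForm τ r I v' with hN'
  have hN0 : 0 ≤ N := regForm_nonneg hτ r I v
  have hN0' : 0 ≤ N' := regForm_nonneg hτ r I v'
  set δ := ‖v - v'‖ with hδ
  have hδ0 : 0 ≤ δ := norm_nonneg _
  have hs : 0 < Real.sqrt τ := Real.sqrt_pos.2 hτ
  have hss : Real.sqrt τ ^ 2 = τ := Real.sq_sqrt hτ.le
  set e := δ / Real.sqrt τ with he
  have he0 : 0 ≤ e := by positivity
  have hδe : δ = e * Real.sqrt τ := by rw [he]; field_simp
  have h4 : ‖(τ : ℂ) • y + (v - v')‖ ≤ τ * ‖y‖ + δ := by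
    refine (norm_add_le _ _).trans (le_of_eq ?_)
    rw [norm_smul, Complex.norm_real, Real.norm_of_nonneg hτ.le]
  have h5 := pow_le_pow_left₀ (norm_nonneg _) h4 2
  have h6 : (Real.sqrt τ * ‖y‖) ^ 2 ≤ N' := by
    rw [mul_pow, hss, h2]
    have : 0 ≤ ∑ i ∈ I, ‖inner ℂ (r i) y‖ ^ 2 := Finset.sum_nonneg fun i _ => by positivity
    linarith
  set q := Real.sqrt τ * ‖y‖ with hq
  have h7 : 2 * q ≤ 1 + N' := by nlinarith [sq_nonneg (q - 1)]
  have h8 : τ * N ≤ τ * (N' + 2 * q * e + e ^ 2) := by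
    have e1 : τ * (N' + 2 * q * e + e ^ 2) =
        (τ * ‖y‖ + δ) ^ 2 + τ * ∑ i ∈ I, ‖inner ℂ (r i) y‖ ^ 2 := by
      rw [h2, hδe, hq]
      linear_combination (-e ^ 2) * hss
    rw [e1]
    linarith
  have h9 : N ≤ N' + 2 * q * e + e ^ 2 := le_of_mul_le_mul_left h8 hτ
  have h10 : 1 + N ≤ (1 + N') * Real.exp (2 * e) := by
    have := Real.quadratic_le_exp_of_nonneg (show 0 ≤ 2 * e by positivity)
    have h11 : 1 + N ≤ (1 + N') * (1 + e + e ^ 2) := by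
      nlinarith [mul_nonneg hN0' (sq_nonneg e)]
    refine h11.trans (mul_le_mul_of_nonneg_left ?_ (by linarith))
    nlinarith [sq_nonneg e]
  have h12 := Real.log_le_log (by linarith) h10
  rw [Real.log_mul (by linarith) (Real.exp_pos _).ne', Real.log_exp] at h12
  linarith

theorem abs_log_one_add_regForm_sub_le {τ : ℝ} (hτ : 0 < τ) (r : ι → E) (I : Finset ι)
    (v v' : E) :
    |Real.log (1 + regForm τ r I v) - Real.log (1 + regForm τ r I v')| ≤
      2 * (‖v - v'‖ / Real.sqrt τ) := by
  refine abs_sub_le_iff.2 ⟨log_one_add_regForm_sub_le hτ r I v v', ?_⟩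
  rw [norm_sub_rev]
  exact log_one_add_regForm_sub_le hτ r I v' v

/-- The logarithm of the determinant of `τ + ∑ i ∈ I, r i (r i)*`. -/
noncomputable def regLogDet (τ : ℝ) (r : ι → E) (I : Finset ι) : ℝ :=
  Real.log ‖LinearMap.det (regOp τ r I)‖

theorem regLogDet_empty {τ : ℝ} (hτ : 0 < τ) (r : ι → E) :
    regLogDet τ r ∅ = Module.finrank ℂ E * Real.log τ := by
  unfold regLogDet regOp
  rw [Finset.sum_empty, add_zero, LinearMap.det_smul, LinearMap.det_id, mul_one, norm_pow,
    Complex.norm_real, Real.norm_of_nonneg hτ.le, Real.log_pow]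

theorem det_regOp_ne_zero {τ : ℝ} (hτ : 0 < τ) (r : ι → E) (I : Finset ι) :
    LinearMap.det (regOp τ r I) ≠ 0 := by
  have h := LinearEquiv.isUnit_det' (LinearEquiv.ofInjectiveEndo _ (regOp_injective hτ r I))
  exact h.ne_zero

/-- The rank-one determinant formula: adding r_i r_i* composes the operator with the transvection x
↦ x + ⟨r_i, x⟩ y, where y is the preimage of r_i. -/
theorem regLogDet_insert [DecidableEq ι] {τ : ℝ} (hτ : 0 < τ) (r : ι → E) {I : Finset ι} {i : ι}
    (hi : i ∉ I) :
    regLogDet τ r (insert i I) = regLogDet τ r I + Real.log (1 + regForm τ r I (r i)) := by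
  obtain ⟨y, h0, h1, -⟩ := exists_regForm_eq hτ r I (r i)
  have hN := regForm_nonneg hτ r I (r i)
  have h2 : regOp τ r (insert i I) =
      regOp τ r I ∘ₗ LinearMap.transvection (innerₛₗ ℂ (r i)) y := by
    ext x
    rw [LinearMap.comp_apply, LinearMap.transvection.apply, map_add, map_smul, h0, regOp_apply,
      regOp_apply, Finset.sum_insert hi, innerₛₗ_apply_apply]
    abel
  unfold regLogDet
  rw [h2, LinearMap.det_comp, LinearMap.transvection.det, innerₛₗ_apply_apply, h1, norm_mul]
  have h3 : ‖(1 : ℂ) + (regForm τ r I (r i) : ℂ)‖ = 1 + regForm τ r I (r i) := by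
    rw [← Complex.ofReal_one, ← Complex.ofReal_add, Complex.norm_real, Real.norm_of_nonneg]
    linarith
  rw [h3, Real.log_mul (norm_ne_zero_iff.2 (det_regOp_ne_zero hτ r I)) (by linarith)]

theorem regForm_congr {τ : ℝ} (hτ : 0 < τ) {r r' : ι → E} {I : Finset ι}
    (h : ∀ i ∈ I, r i = r' i) (v : E) : regForm τ r I v = regForm τ r' I v := by
  obtain ⟨y, h0, h1, -⟩ := exists_regForm_eq hτ r I v
  obtain ⟨y', h0', h1', -⟩ := exists_regForm_eq hτ r' I v
  rw [← regOp_congr h, ← h0] at h0'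
  have := regOp_injective hτ r I h0'
  rw [this, h1] at h1'
  exact_mod_cast h1'

/-- The effect on the log-determinant of a change of one of the vectors. -/
theorem abs_regLogDet_sub_le [DecidableEq ι] {τ : ℝ} (hτ : 0 < τ) {r r' : ι → E} (I : Finset ι)
    (i : ι) (h : ∀ j, j ≠ i → r j = r' j) :
    |regLogDet τ r I - regLogDet τ r' I| ≤ 2 * (‖r i - r' i‖ / Real.sqrt τ) := by
  by_cases hi : i ∈ I
  · have hc : ∀ j ∈ I.erase i, r j = r' j := fun j hj => h j (Finset.ne_of_mem_erase hj)
    rw [← Finset.insert_erase hi, regLogDet_insert hτ r (Finset.notMem_erase i I),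
      regLogDet_insert hτ r' (Finset.notMem_erase i I)]
    have h1 : regLogDet τ r (I.erase i) = regLogDet τ r' (I.erase i) := by
      unfold regLogDet; rw [regOp_congr hc]
    rw [h1, regForm_congr hτ hc, add_sub_add_left_eq_sub]
    exact abs_log_one_add_regForm_sub_le hτ _ _ _ _
  · have hc : ∀ j ∈ I, r j = r' j := fun j hj => h j (fun e => hi (e ▸ hj))
    unfold regLogDet
    rw [regOp_congr hc, sub_self, abs_zero]
    positivity

end Regularization

/-! ### Volume against regularized determinant -/

section RowVolume

variable {n : ℕ}

/-- The indices of the first `m` rows. -/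
def firstRows (n m : ℕ) : Finset (Fin n) := Finset.univ.filter fun i => (i : ℕ) < m

theorem mem_firstRows {m : ℕ} {i : Fin n} : i ∈ firstRows n m ↔ (i : ℕ) < m := by
  simp [firstRows]

theorem firstRows_succ {m : ℕ} (h : m < n) :
    firstRows n (m + 1) = insert ⟨m, h⟩ (firstRows n m) := by
  ext i
  rw [Finset.mem_insert, mem_firstRows, mem_firstRows, Fin.ext_iff]
  change (i : ℕ) < m + 1 ↔ (i : ℕ) = m ∨ _
  omega

theorem notMem_firstRows_self {m : ℕ} (h : m < n) : (⟨m, h⟩ : Fin n) ∉ firstRows n m := by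
  simp [mem_firstRows]

theorem card_firstRows {m : ℕ} (h : m ≤ n) : (firstRows n m).card = m := by
  induction m with
  | zero => simp [firstRows]
  | succ m ih =>
    rw [firstRows_succ h, Finset.card_insert_of_notMem (notMem_firstRows_self h),
      ih (by omega)]

theorem prevSpan_eq (M : Matrix (Fin n) (Fin n) ℂ) (i : Fin n) :
    prevSpan M i = Submodule.span ℂ (rowVec M '' (firstRows n i)) := by
  unfold prevSpan
  congr 2
  ext j
  simp [mem_firstRows]

variable {E : Type*} [NormedAddCommGroup E] [InnerProductSpace ℂ E]

theorem exists_sum_smul_of_mem_span {F ι : Type*} [AddCommGroup F] [Module ℂ F] {r : ι → F}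
    {I : Finset ι} {v : F} (h : v ∈ Submodule.span ℂ (r '' I)) :
    ∃ c : ι → ℂ, ∑ i ∈ I, c i • r i = v := by
  classical
  obtain ⟨c, hc⟩ := (Submodule.mem_span_image_finset_iff_exists_fun ℂ).1 h
  refine ⟨fun i => if hi : i ∈ I then c ⟨i, hi⟩ else 0, ?_⟩
  rw [← hc, ← Finset.sum_coe_sort]
  exact Finset.sum_congr rfl fun i _ => by simp

/-- The dual vector y is orthogonal to the other r_j, and r_i - y/‖y‖² lies in their span. Hence
that span is within 1/‖y‖ of r_i. -/
theorem norm_sq_le_of_biorthogonal {ι : Type*} [DecidableEq ι] {r : ι → E} {I : Finset ι} {i : ι}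
    (hi : i ∈ I) {y : E} (hy : y ∈ Submodule.span ℂ (r '' I))
    (hyr : ∀ j ∈ I, inner ℂ y (r j) = if i = j then (1 : ℂ) else 0) {a : ℝ} (ha : 0 < a)
    (hd : a ≤ Metric.infDist (r i) (Submodule.span ℂ (r '' (I.erase i)) : Set E)) :
    ‖y‖ ^ 2 ≤ 1 / a ^ 2 := by
  obtain ⟨b, hb⟩ := exists_sum_smul_of_mem_span hy
  have h1 : b i = ((‖y‖ ^ 2 : ℝ) : ℂ) := by
    have h2 : inner ℂ y y = b i := by
      nth_rw 2 [← hb]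
      rw [inner_sum, Finset.sum_eq_single_of_mem i hi]
      · rw [inner_smul_right, hyr i hi, if_pos rfl, mul_one]
      · intro j hj hji
        rw [inner_smul_right, hyr j hj, if_neg (Ne.symm hji), mul_zero]
    rw [← h2, inner_self_eq_norm_sq_to_K]
    push_cast; rfl
  have hy0 : y ≠ 0 := by
    rintro rfl
    simpa using hyr i hi
  have hyn : 0 < ‖y‖ := norm_pos_iff.2 hy0
  have hc : ((‖y‖ ^ 2 : ℝ) : ℂ) ≠ 0 := by exact_mod_cast (pow_pos hyn 2).ne'
  rw [← Finset.add_sum_erase _ _ hi, h1] at hb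
  have hmem : r i - (((‖y‖ ^ 2 : ℝ) : ℂ)⁻¹) • y ∈ Submodule.span ℂ (r '' (I.erase i)) := by
    have : r i - (((‖y‖ ^ 2 : ℝ) : ℂ)⁻¹) • y =
        -((((‖y‖ ^ 2 : ℝ) : ℂ)⁻¹) • ∑ j ∈ I.erase i, b j • r j) := by
      nth_rw 2 [← hb]
      rw [smul_add, smul_smul, inv_mul_cancel₀ hc, one_smul]
      abel
    rw [this]
    refine Submodule.neg_mem _ (Submodule.smul_mem _ _ (Submodule.sum_mem _ fun j hj =>
      Submodule.smul_mem _ _ (Submodule.subset_span (Set.mem_image_of_mem r hj))))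
  have h3 := hd.trans (Metric.infDist_le_dist_of_mem hmem)
  rw [dist_eq_norm, sub_sub_cancel, norm_smul, norm_inv, Complex.norm_real,
    Real.norm_of_nonneg (by positivity)] at h3
  have h4 : (‖y‖ ^ 2)⁻¹ * ‖y‖ = 1 / ‖y‖ := by field_simp
  rw [h4, le_div_iff₀ hyn] at h3
  rw [le_div_iff₀ (by positivity), ← mul_pow]
  exact pow_le_one₀ (by positivity) (by linarith)

variable [FiniteDimensional ℂ E]

theorem regLogDet_firstRows {τ : ℝ} (hτ : 0 < τ) (r : Fin n → E) {m : ℕ} (hm : m ≤ n) :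
    regLogDet τ r (firstRows n m) = Module.finrank ℂ E * Real.log τ +
      ∑ i ∈ firstRows n m, Real.log (1 + regForm τ r (firstRows n i) (r i)) := by
  induction m with
  | zero =>
    have : firstRows n 0 = ∅ := by ext; simp [firstRows]
    rw [this, regLogDet_empty hτ]; simp
  | succ m ih =>
    rw [firstRows_succ hm, regLogDet_insert hτ r (notMem_firstRows_self hm), ih (by omega),
      Finset.sum_insert (notMem_firstRows_self hm)]
    ring

/-- The dual basis of the first `k` vectors, and the contribution of these vectors to the
regularization error. -/
theorem exists_biorthogonal {τ : ℝ} (hτ : 0 < τ) (r : Fin n → E) {k : ℕ} (hk : k ≤ n)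
    (hd : ∀ i ∈ firstRows n k,
      0 < Metric.infDist (r i) (Submodule.span ℂ (r '' (firstRows n i)) : Set E)) :
    ∃ y : Fin n → E, (∀ i ∈ firstRows n k, y i ∈ Submodule.span ℂ (r '' (firstRows n k))) ∧
      (∀ i ∈ firstRows n k, ∀ j ∈ firstRows n k,
        inner ℂ (y i) (r j) = if i = j then (1 : ℂ) else 0) ∧
      ∑ i ∈ firstRows n k, (τ * (1 + regForm τ r (firstRows n i) (r i)) /
        Metric.infDist (r i) (Submodule.span ℂ (r '' (firstRows n i)) : Set E) ^ 2 - 1) ≤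
        τ * ∑ i ∈ firstRows n k, ‖y i‖ ^ 2 := by
  induction k with
  | zero =>
    have : firstRows n 0 = ∅ := by ext; simp [firstRows]
    exact ⟨0, by simp [this]⟩
  | succ k ih =>
    have hsucc := firstRows_succ (n := n) hk
    set i0 : Fin n := ⟨k, hk⟩ with hi0
    have hnot : i0 ∉ firstRows n k := notMem_firstRows_self hk
    obtain ⟨y, hy1, hy2, hy3⟩ := ih (by omega) fun i hi => hd i (by
      rw [hsucc]; exact Finset.mem_insert_of_mem hi)
    have hd0 := hd i0 (by rw [hsucc]; exact Finset.mem_insert_self _ _)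
    have hi0k : firstRows n (i0 : ℕ) = firstRows n k := rfl
    rw [hi0k] at hd0
    set V := Submodule.span ℂ (r '' (firstRows n k)) with hV
    obtain ⟨c, hc⟩ : ∃ c : Fin n → ℂ, ∑ j ∈ firstRows n k, c j • r j = V.starProjection (r i0) := by
      have h1 : V.starProjection (r i0) ∈ Submodule.span ℂ (r '' (firstRows n k)) :=
        V.starProjection_apply_mem (r i0)
      exact exists_sum_smul_of_mem_span h1
    set p := Vᗮ.starProjection (r i0) with hp
    have hpV : p ∈ Vᗮ := Vᗮ.starProjection_apply_mem (r i0)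
    have hsplit : r i0 = p + ∑ j ∈ firstRows n k, c j • r j := by
      rw [hc, hp, V.starProjection_orthogonal']
      change r i0 = (r i0 - V.starProjection (r i0)) + _
      abel
    have hpd : Metric.infDist (r i0) (V : Set E) = ‖p‖ := infDist_eq_norm_starProjection V _
    rw [hpd] at hd0
    have hpV' : ∀ v ∈ V, inner ℂ v p = 0 := fun v hv => (V.mem_orthogonal p).1 hpV v hv
    have hpV'' : ∀ v ∈ V, inner ℂ p v = 0 := fun v hv => (V.mem_orthogonal' p).1 hpV v hv
    have hrV : ∀ j ∈ firstRows n k, r j ∈ V := fun j hj =>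
      Submodule.subset_span (Set.mem_image_of_mem r hj)
    have hpr : inner ℂ p (r i0) = ((‖p‖ ^ 2 : ℝ) : ℂ) := by
      rw [hsplit, inner_add_right, hpV'' _ (Submodule.sum_mem _ fun j hj =>
        Submodule.smul_mem _ _ (hrV j hj)), add_zero, inner_self_eq_norm_sq_to_K]
      push_cast; rfl
    have hyr : ∀ i ∈ firstRows n k, inner ℂ (y i) (r i0) = c i := by
      intro i hi
      rw [hsplit, inner_add_right, hpV' _ (hy1 i hi), zero_add, inner_sum,
        Finset.sum_eq_single_of_mem i hi]
      · rw [inner_smul_right, hy2 i hi i hi, if_pos rfl, mul_one]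
      · intro j hj hji
        rw [inner_smul_right, hy2 i hi j hj, if_neg (Ne.symm hji), mul_zero]
    have hp2 : ((‖p‖ ^ 2 : ℝ) : ℂ) ≠ 0 := by
      exact_mod_cast (pow_pos hd0 2).ne'
    set q : E := (((‖p‖ ^ 2 : ℝ) : ℂ)⁻¹) • p with hq
    have hqr : inner ℂ q (r i0) = 1 := by
      rw [hq, inner_smul_left, hpr, map_inv₀, Complex.conj_ofReal, inv_mul_cancel₀ hp2]
    have hqV : ∀ v ∈ V, inner ℂ q v = 0 := by
      intro v hv
      rw [hq, inner_smul_left, hpV'' v hv, mul_zero]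
    have hqV' : ∀ v ∈ V, inner ℂ v q = 0 := by
      intro v hv
      rw [hq, inner_smul_right, hpV' v hv, mul_zero]
    have hqn : ‖q‖ ^ 2 = 1 / ‖p‖ ^ 2 := by
      rw [hq, norm_smul, norm_inv, Complex.norm_real, Real.norm_of_nonneg (by positivity)]
      field_simp
    have hVle : V ≤ Submodule.span ℂ (r '' (firstRows n (k + 1))) := by
      refine Submodule.span_mono (Set.image_mono ?_)
      rw [hsucc]; simp
    have hqmem : q ∈ Submodule.span ℂ (r '' (firstRows n (k + 1))) := by
      refine Submodule.smul_mem _ _ ?_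
      have : p = r i0 - ∑ j ∈ firstRows n k, c j • r j := by rw [hsplit]; abel
      rw [this]
      refine Submodule.sub_mem _ (Submodule.subset_span (Set.mem_image_of_mem r ?_))
        (hVle (Submodule.sum_mem _ fun j hj => Submodule.smul_mem _ _ (hrV j hj)))
      rw [hsucc]; simp
    -- The new row r i0 has dual vector q = p/‖p‖², with p its component orthogonal to the earlier
    -- rows. Each old dual vector is corrected by a multiple of q to become orthogonal to r i0;
    -- since q is orthogonal to it, its squared norm grows by |c_i|²/‖p‖².
    refine ⟨fun i => if i = i0 then q else y i - (starRingEnd ℂ (c i)) • q, ?_, ?_, ?_⟩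
    · intro i hi
      by_cases h : i = i0
      · simpa [h] using hqmem
      · simp only [h, if_false]
        rw [hsucc, Finset.mem_insert] at hi
        exact Submodule.sub_mem _ (hVle (hy1 i (hi.resolve_left h)))
          (Submodule.smul_mem _ _ hqmem)
    · intro i hi j hj
      rw [hsucc, Finset.mem_insert] at hi hj
      by_cases h : i = i0
      · by_cases h' : j = i0
        · simp [h, h', hqr]
        · simp [h, Ne.symm h', hqV _ (hrV j (hj.resolve_left h'))]
      · have hi' := hi.resolve_left h
        simp only [h, if_false]
        by_cases h' : j = i0
        · rw [h', if_neg h, inner_sub_left, hyr i hi', inner_smul_left, hqr]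
          simp
        · have hj' := hj.resolve_left h'
          rw [inner_sub_left, hy2 i hi' j hj', inner_smul_left, hqV _ (hrV j hj')]
          simp
    · rw [hsucc, Finset.sum_insert hnot, Finset.sum_insert hnot, hi0k, hpd]
      simp only [if_true]
      have h1 : ∀ i ∈ firstRows n k,
          ‖if i = i0 then q else y i - (starRingEnd ℂ (c i)) • q‖ ^ 2 =
            ‖y i‖ ^ 2 + ‖c i‖ ^ 2 * (1 / ‖p‖ ^ 2) := by
        intro i hi
        have hne : i ≠ i0 := fun h => hnot (h ▸ hi)
        rw [if_neg hne, ← hqn, ← RCLike.norm_conj (c i), ← mul_pow, ← norm_smul,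
          norm_sub_sq (𝕜 := ℂ), inner_smul_right, hqV' _ (hy1 i hi)]
        simp
      rw [Finset.sum_congr rfl h1, Finset.sum_add_distrib, ← Finset.sum_mul, hqn]
      have h2 := mul_regForm_le hτ hsplit
      -- The growth of the squared norms is exactly what the variational bound requires for r i0 = p
      -- + ∑ c_j r_j.
      have h3 : τ * (1 + regForm τ r (firstRows n k) (r i0)) / ‖p‖ ^ 2 - 1 ≤
          τ * (1 / ‖p‖ ^ 2 + (∑ i ∈ firstRows n k, ‖c i‖ ^ 2) * (1 / ‖p‖ ^ 2)) := by
        have hp0 : 0 < ‖p‖ ^ 2 := by positivity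
        rw [sub_le_iff_le_add, div_le_iff₀ hp0]
        have : (τ * (1 / ‖p‖ ^ 2 + (∑ i ∈ firstRows n k, ‖c i‖ ^ 2) * (1 / ‖p‖ ^ 2)) + 1) * ‖p‖ ^ 2
            = τ * (1 + ∑ i ∈ firstRows n k, ‖c i‖ ^ 2) + ‖p‖ ^ 2 := by
          field_simp
        rw [this]
        linarith
      linarith

/-- The volume spanned by the first `m` rows is positive and close to the regularized determinant,
if the rows are far enough from the spans of the other rows. -/
theorem rowVolume_pos_and_abs_log_sub_le {τ a : ℝ} (hτ : 0 < τ) (ha : 0 < a) {k m : ℕ}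
    (hkm : k ≤ m) (hm : m ≤ n) (M : Matrix (Fin n) (Fin n) ℂ) {K : ℝ}
    (hK : ∀ i, τ + ‖rowVec M i‖ ^ 2 ≤ K)
    (h1 : ∀ i ∈ firstRows n k, a ≤ Metric.infDist (rowVec M i)
      (Submodule.span ℂ (rowVec M '' ((firstRows n k).erase i)) : Set _))
    (h2 : ∀ i ∈ firstRows n m, k ≤ (i : ℕ) → 1 ≤ Metric.infDist (rowVec M i)
      (Submodule.span ℂ (rowVec M '' (firstRows n i)) : Set _)) :
    0 < rowVolume m M ∧
      |2 * Real.log (rowVolume m M) -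
        (regLogDet τ (rowVec M) (firstRows n m) + (m - n : ℝ) * Real.log τ)| ≤
        τ * k / a ^ 2 + (m - k : ℝ) * Real.log K := by
  set r := rowVec M with hr
  set d : Fin n → ℝ := fun i =>
    Metric.infDist (r i) (Submodule.span ℂ (r '' (firstRows n i)) : Set _) with hd
  have hsub : firstRows n k ⊆ firstRows n m := fun i hi => by
    rw [mem_firstRows] at *; omega
  have hda : ∀ i ∈ firstRows n k, a ≤ d i := by
    intro i hi
    refine (h1 i hi).trans (Metric.infDist_le_infDist_of_subset ?_ ⟨0, Submodule.zero_mem _⟩)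
    refine Submodule.span_mono (Set.image_mono ?_)
    intro j hj
    rw [Finset.mem_coe, mem_firstRows] at *
    rw [Finset.mem_erase, mem_firstRows]
    exact ⟨fun e => by omega, by omega⟩
  have hdpos : ∀ i ∈ firstRows n m, 0 < d i := by
    intro i hi
    rcases lt_or_ge (i : ℕ) k with h | h
    · exact ha.trans_le (hda i (mem_firstRows.2 h))
    · exact one_pos.trans_le (h2 i hi h)
  have hvol : rowVolume m M = ∏ i ∈ firstRows n m, d i := by
    unfold rowVolume
    refine Finset.prod_congr rfl fun i _ => ?_
    rw [prevSpan_eq]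
  refine ⟨by rw [hvol]; exact Finset.prod_pos hdpos, ?_⟩
  set N : Fin n → ℝ := fun i => regForm τ r (firstRows n i) (r i) with hN
  have hN0 : ∀ i, 0 ≤ N i := fun i => regForm_nonneg hτ _ _ _
  have hdN : ∀ i, d i ^ 2 ≤ τ * (1 + N i) := fun i => by
    have := infDist_sq_le_mul_regForm hτ r (firstRows n i) (r i)
    simp only [hd, hN]
    linarith
  -- The regularization error is an exact telescoped sum. The m rows account for m of the n factors
  -- τ in det(τ · id), whence the term (m - n) log τ.
  have hR : ∑ i ∈ firstRows n m, Real.log (τ * (1 + N i) / d i ^ 2) =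
      -(2 * Real.log (rowVolume m M) - (regLogDet τ r (firstRows n m) +
        (m - n : ℝ) * Real.log τ)) := by
    rw [hvol, Real.log_prod fun i hi => (hdpos i hi).ne', regLogDet_firstRows hτ r hm,
      finrank_euclideanSpace_fin]
    have : ∀ i ∈ firstRows n m, Real.log (τ * (1 + N i) / d i ^ 2) =
        Real.log τ + Real.log (1 + N i) - 2 * Real.log (d i) := by
      intro i hi
      have h3 := hdpos i hi
      have h4 := hN0 i
      rw [Real.log_div (by positivity) (by positivity), Real.log_mul hτ.ne' (by positivity),
        Real.log_pow]
      norm_num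
    rw [Finset.sum_congr rfl this, Finset.sum_sub_distrib, Finset.sum_add_distrib,
      Finset.sum_const, card_firstRows hm, ← Finset.mul_sum, nsmul_eq_mul]
    ring
  have hpos : ∀ i ∈ firstRows n m, 0 ≤ Real.log (τ * (1 + N i) / d i ^ 2) := by
    intro i hi
    refine Real.log_nonneg ?_
    rw [le_div_iff₀ (pow_pos (hdpos i hi) 2), one_mul]
    exact hdN i
  rw [← abs_neg, ← hR, abs_of_nonneg (Finset.sum_nonneg hpos), ← Finset.sum_sdiff hsub, add_comm]
  refine add_le_add ?_ ?_
  · obtain ⟨y, hy1, hy2, hy3⟩ := exists_biorthogonal hτ r (hkm.trans hm)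
      (fun i hi => hdpos i (hsub hi))
    calc _ ≤ ∑ i ∈ firstRows n k, (τ * (1 + N i) / d i ^ 2 - 1) := by
          refine Finset.sum_le_sum fun i hi => Real.log_le_sub_one_of_pos ?_
          have h3 := hdpos i (hsub hi)
          have h4 := hN0 i
          positivity
      _ ≤ τ * ∑ i ∈ firstRows n k, ‖y i‖ ^ 2 := hy3
      _ ≤ τ * ∑ i ∈ firstRows n k, 1 / a ^ 2 := by
          refine mul_le_mul_of_nonneg_left (Finset.sum_le_sum fun i hi => ?_) hτ.le
          exact norm_sq_le_of_biorthogonal hi (hy1 i hi) (hy2 i hi) ha (h1 i hi)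
      _ = _ := by
          rw [Finset.sum_const, card_firstRows (hkm.trans hm), nsmul_eq_mul]
          ring
  -- For the last m - k rows the crude bounds d_i ≥ 1 and τ(1 + N_i) ≤ τ + ‖r_i‖² ≤ K suffice.
  · calc _ ≤ ∑ i ∈ firstRows n m \ firstRows n k, Real.log K := by
          refine Finset.sum_le_sum fun i hi => ?_
          rw [Finset.mem_sdiff, mem_firstRows, mem_firstRows, not_lt] at hi
          have hi' : i ∈ firstRows n m := mem_firstRows.2 hi.1
          have h3 : 1 ≤ d i := h2 i hi' hi.2
          have h4 := hN0 i
          have h5 := mul_regForm_le_norm_sq hτ r (firstRows n i) (r i)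
          refine Real.log_le_log (by positivity) ?_
          rw [div_le_iff₀ (by positivity)]
          have h6 : τ * (1 + N i) ≤ K := by
            have := hK i
            simp only [hN]
            linarith
          have h7 : 0 ≤ K := le_trans (by positivity) h6
          nlinarith [one_le_pow₀ h3 (n := 2)]
      _ = _ := by
          rw [Finset.sum_const, Finset.card_sdiff_of_subset hsub, card_firstRows hm,
            card_firstRows (hkm.trans hm), nsmul_eq_mul, Nat.cast_sub hkm]

end RowVolume

/-! ### The two laws of a row and the coupling by row sums -/

section RowLaws

variable {n : ℕ}

/-- The sum of the sign vector coded by `x`. -/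
def signSum (x : Fin n → Bool) : ℤ := ∑ j, boolSign (x j)

/-- The number of coordinates `1` of the sign vector coded by `x`. -/
def onesCount (x : Fin n → Bool) : ℕ := (Finset.univ.filter fun j => x j = true).card

theorem signSum_eq (x : Fin n → Bool) : signSum x = 2 * (onesCount x : ℤ) - n := by
  have h : ∀ j, boolSign (x j) = 2 * (if x j = true then 1 else 0) - 1 := by
    intro j; cases x j <;> simp [boolSign]
  unfold signSum onesCount
  simp_rw [h]
  rw [Finset.sum_sub_distrib, ← Finset.mul_sum]
  simp

theorem signSum_comp_perm (x : Fin n → Bool) (σ : Equiv.Perm (Fin n)) :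
    signSum (fun j => x (σ j)) = signSum x :=
  Equiv.sum_comp σ fun j => boolSign (x j)

theorem onesCount_le (x : Fin n → Bool) : onesCount x ≤ n :=
  (Finset.card_le_univ _).trans (by simp)

/-- A bijection from a subset of the ones of y onto the ones of x extends to a permutation of all
coordinates. -/
theorem exists_perm_imp {x y : Fin n → Bool} (h : onesCount x ≤ onesCount y) :
    ∃ σ : Equiv.Perm (Fin n), ∀ j, x (σ j) = true → y j = true := by
  obtain ⟨B, hB, hcard⟩ := Finset.exists_subset_card_eq h
  set A := Finset.univ.filter fun j => x j = true with hA
  have e : {j // j ∈ B} ≃ {j // j ∈ A} := Fintype.equivOfCardEq (by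
    rw [Fintype.card_coe, Fintype.card_coe, hcard]; rfl)
  refine ⟨e.extendSubtype, fun j hj => ?_⟩
  by_contra hcon
  have hjB : j ∉ B := fun hjB => hcon (Finset.mem_filter.1 (hB hjB)).2
  exact e.extendSubtype_not_mem j hjB (Finset.mem_filter.2 ⟨Finset.mem_univ _, hj⟩)

/-- Up to a permutation of the coordinates, the distance of two sign vectors is determined by
the difference of their sums. -/
theorem exists_perm_sum_sq_le (x y : Fin n → Bool) : ∃ σ : Equiv.Perm (Fin n),
    ∑ j, ((boolSign (x (σ j)) : ℝ) - boolSign (y j)) ^ 2 ≤ 2 * |(signSum x : ℝ) - signSum y| := by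
  have key : ∀ x y : Fin n → Bool, onesCount x ≤ onesCount y → ∃ σ : Equiv.Perm (Fin n),
      ∑ j, ((boolSign (x (σ j)) : ℝ) - boolSign (y j)) ^ 2 ≤
        2 * |(signSum x : ℝ) - signSum y| := by
    intro x y h
    obtain ⟨σ, hσ⟩ := exists_perm_imp h
    refine ⟨σ, ?_⟩
    have h1 : ∀ j, ((boolSign (x (σ j)) : ℝ) - boolSign (y j)) ^ 2 =
        2 * ((boolSign (y j) : ℝ) - boolSign (x (σ j))) := by
      intro j
      have := hσ j
      cases hx : x (σ j) <;> cases hy : y j <;> simp_all [boolSign]; norm_num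
    simp_rw [h1]
    rw [← Finset.mul_sum, Finset.sum_sub_distrib, abs_sub_comm]
    refine mul_le_mul_of_nonneg_left (le_trans (le_of_eq ?_) (le_abs_self _)) (by norm_num)
    rw [← signSum_comp_perm x σ]
    simp [signSum]
  rcases le_total (onesCount x) (onesCount y) with h | h
  · exact key x y h
  · obtain ⟨σ, hσ⟩ := key y x h
    refine ⟨σ.symm, ?_⟩
    rw [← Equiv.sum_comp σ]
    simp only [Equiv.symm_apply_apply]
    rw [abs_sub_comm]
    convert hσ using 2 with j
    ring

theorem prodExp_sq_signSum_sub {w : Bool → ℝ} (hw1 : ∑ b, w b = 1) (d : ℝ) :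
    prodExp w (fun x : Fin n → Bool => ((signSum x : ℝ) - n * (w true - w false) + d) ^ 2) =
      n * (4 * (w true * w false)) + d ^ 2 := by
  induction n generalizing d with
  | zero => simp [prodExp_zero, signSum]
  | succ n ih =>
    rw [prodExp_succ, Fintype.sum_bool]
    have hb : w true = 1 - w false := by
      have : w true + w false = 1 := by simpa using hw1
      linarith
    have e : ∀ b, prodExp w (fun a : Fin n → Bool =>
        ((signSum (Fin.cons b a : Fin (n + 1) → Bool) : ℝ) - (n + 1 : ℕ) * (w true - w false) + d)
          ^ 2) = n * (4 * (w true * w false)) + (boolSign b - (w true - w false) + d) ^ 2 := by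
      intro b
      rw [← ih]
      congr 1; ext a
      simp only [signSum, Fin.sum_univ_succ, Fin.cons_zero, Fin.cons_succ]
      push_cast; ring
    rw [e, e, hb]
    simp only [boolSign]
    push_cast
    ring

/-- The weights of the two signs in the Bernoulli model. -/
noncomputable def bitWeight (n : ℕ) (s : ℤ) (b : Bool) : ℝ := 1 / 2 + boolSign b * (s / (2 * n))

/-- The weights of the rows in the Bernoulli model. -/
noncomputable def iidWeight (n : ℕ) (s : ℤ) (x : Fin n → Bool) : ℝ := ∏ j, bitWeight n s (x j)

/-- The sign vectors of sum `s - 1` or `s + 1`. -/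
def layer (n : ℕ) (s : ℤ) : Finset (Fin n → Bool) :=
  Finset.univ.filter fun x => signSum x = s - 1 ∨ signSum x = s + 1

/-- The weights of the rows in the model of given row sums. -/
noncomputable def layerWeight (n : ℕ) (s : ℤ) (x : Fin n → Bool) : ℝ :=
  if x ∈ layer n s then 1 / ((layer n s).card : ℝ) else 0

theorem mem_layer {s : ℤ} {x : Fin n → Bool} :
    x ∈ layer n s ↔ signSum x = s - 1 ∨ signSum x = s + 1 := by
  simp [layer]

theorem layerWeight_nonneg (s : ℤ) (x : Fin n → Bool) : 0 ≤ layerWeight n s x := by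
  unfold layerWeight; split_ifs <;> positivity

theorem sum_layerWeight {s : ℤ} (h : (layer n s).Nonempty) : ∑ x, layerWeight n s x = 1 := by
  unfold layerWeight
  rw [Finset.sum_ite_mem, Finset.univ_inter, Finset.sum_const, nsmul_eq_mul]
  have : ((layer n s).card : ℝ) ≠ 0 := by exact_mod_cast h.card_pos.ne'
  field_simp

theorem layerWeight_comp_perm (s : ℤ) (x : Fin n → Bool) (σ : Equiv.Perm (Fin n)) :
    layerWeight n s (fun j => x (σ j)) = layerWeight n s x := by
  simp only [layerWeight, mem_layer, signSum_comp_perm]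

theorem iidWeight_comp_perm (s : ℤ) (x : Fin n → Bool) (σ : Equiv.Perm (Fin n)) :
    iidWeight n s (fun j => x (σ j)) = iidWeight n s x :=
  Equiv.prod_comp σ fun j => bitWeight n s (x j)

theorem sum_bitWeight (n : ℕ) (s : ℤ) : ∑ b, bitWeight n s b = 1 := by
  simp [bitWeight, boolSign]; ring

theorem half_le_bitWeight {ε : ℝ} (hn : 0 < n) {s : ℤ} (hs : |(s : ℝ)| ≤ (1 - ε) * n) (b : Bool) :
    ε / 2 ≤ bitWeight n s b := by
  have hn' : (0 : ℝ) < n := by exact_mod_cast hn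
  have h1 : |(s : ℝ) / (2 * n)| ≤ (1 - ε) / 2 := by
    rw [abs_div, abs_of_pos (show (0 : ℝ) < 2 * n by positivity), div_le_iff₀ (by positivity)]
    linarith
  have h2 := abs_le.1 h1
  cases b
  · simp [bitWeight, boolSign]; linarith
  · simp [bitWeight, boolSign]; linarith

theorem bitWeight_nonneg {ε : ℝ} (hε : 0 < ε) (hn : 0 < n) {s : ℤ}
    (hs : |(s : ℝ)| ≤ (1 - ε) * n) (b : Bool) : 0 ≤ bitWeight n s b :=
  le_trans (by linarith) (half_le_bitWeight hn hs b)

theorem iidWeight_nonneg {ε : ℝ} (hε : 0 < ε) (hn : 0 < n) {s : ℤ}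
    (hs : |(s : ℝ)| ≤ (1 - ε) * n) (x : Fin n → Bool) : 0 ≤ iidWeight n s x :=
  Finset.prod_nonneg fun _ _ => bitWeight_nonneg hε hn hs _

theorem sum_iidWeight (n : ℕ) (s : ℤ) : ∑ x : Fin n → Bool, iidWeight n s x = 1 :=
  sum_prod_eq_one (sum_bitWeight n s)

theorem sum_iidWeight_mul (s : ℤ) (g : (Fin n → Bool) → ℝ) :
    ∑ x, iidWeight n s x * g x = prodExp (bitWeight n s) g := rfl

/-- The row sum has mean s and variance at most n; the bound |u| ≤ u²/(2√n) + √n/2 converts this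
into a first moment. -/
theorem sum_iidWeight_mul_abs_le {ε : ℝ} (hε : 0 < ε) (hn : 0 < n) {s : ℤ}
    (hs : |(s : ℝ)| ≤ (1 - ε) * n) :
    ∑ x : Fin n → Bool, iidWeight n s x * |(signSum x : ℝ) - s| ≤ Real.sqrt n := by
  have hn' : (0 : ℝ) < n := by exact_mod_cast hn
  have hsq : 0 < Real.sqrt n := Real.sqrt_pos.2 hn'
  have hss : Real.sqrt n ^ 2 = n := Real.sq_sqrt hn'.le
  have h1 := prodExp_sq_signSum_sub (n := n) (sum_bitWeight n s) 0
  have e : (n : ℝ) * (bitWeight n s true - bitWeight n s false) = s := by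
    simp [bitWeight, boolSign]; field_simp; ring
  have h2 : 4 * (bitWeight n s true * bitWeight n s false) ≤ 1 := by
    have := sum_bitWeight n s
    rw [Fintype.sum_bool] at this
    nlinarith [sq_nonneg (bitWeight n s true - bitWeight n s false)]
  simp only [e, add_zero] at h1
  rw [sum_iidWeight_mul]
  calc _ ≤ prodExp (bitWeight n s) (fun x : Fin n → Bool =>
        1 / (2 * Real.sqrt n) * ((signSum x : ℝ) - s) ^ 2 + Real.sqrt n / 2) := by
        refine prodExp_mono (bitWeight_nonneg hε hn hs) fun x => ?_
        rw [← sub_nonneg]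
        have : 1 / (2 * Real.sqrt n) * ((signSum x : ℝ) - s) ^ 2 + Real.sqrt n / 2 -
            |(signSum x : ℝ) - s| =
            1 / (2 * Real.sqrt n) * (|(signSum x : ℝ) - s| - Real.sqrt n) ^ 2 := by
          rw [← sq_abs ((signSum x : ℝ) - s)]
          field_simp
          ring
        rw [this]
        positivity
    _ ≤ 1 / (2 * Real.sqrt n) * n + Real.sqrt n / 2 := by
        rw [prodExp_add, prodExp_const (sum_bitWeight n s), prodExp_const_mul, h1]
        gcongr
        nlinarith
    _ = Real.sqrt n := by
        nth_rw 2 [← hss]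
        field_simp
        ring

/-- The expectations of a Lipschitz function under the two laws of a row are close. -/
theorem abs_sum_iidWeight_sub_sum_layerWeight_le {ε : ℝ} (hε : 0 < ε) (hn : 0 < n) {s : ℤ}
    (hs : |(s : ℝ)| ≤ (1 - ε) * n) (hne : (layer n s).Nonempty) {g : (Fin n → Bool) → ℝ} {L : ℝ}
    (hL : 0 ≤ L)
    (hg : ∀ x y, |g x - g y| ≤ L * Real.sqrt (∑ j, ((boolSign (x j) : ℝ) - boolSign (y j)) ^ 2)) :
    |∑ x, iidWeight n s x * g x - ∑ x, layerWeight n s x * g x| ≤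
      L * Real.sqrt (2 * (Real.sqrt n + 1)) := by
  -- Symmetrization over all permutations multiplies both expectations by the same N, since both
  -- laws are exchangeable. The resulting G depends on the row sum only, and its increments are
  -- bounded by the difference of the sums.
  set G : (Fin n → Bool) → ℝ := fun x => ∑ π : Equiv.Perm (Fin n), g (fun j => x (π j)) with hG
  obtain ⟨N, hN⟩ : ∃ N : ℝ, N = ((Fintype.card (Equiv.Perm (Fin n)) : ℕ) : ℝ) := ⟨_, rfl⟩
  have hN0 : 0 < N := by rw [hN]; exact_mod_cast Fintype.card_pos
  have hsym : ∀ w : (Fin n → Bool) → ℝ, (∀ x (σ : Equiv.Perm (Fin n)),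
      w (fun j => x (σ j)) = w x) → ∑ x, w x * G x = N * ∑ x, w x * g x := by
    intro w hw
    simp only [hG, Finset.mul_sum]
    rw [Finset.sum_comm]
    have : ∀ π : Equiv.Perm (Fin n), ∑ x, w x * g (fun j => x (π j)) = ∑ x, w x * g x := by
      intro π
      rw [← Equiv.sum_comp (Equiv.arrowCongr π.symm (Equiv.refl Bool)) fun x => w x * g x]
      refine Finset.sum_congr rfl fun x _ => ?_
      rw [← hw x π]
      rfl
    simp_rw [← Finset.mul_sum, this]
    rw [Finset.sum_const, nsmul_eq_mul, Finset.card_univ, ← hN]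
  have hGinv : ∀ x (σ : Equiv.Perm (Fin n)), G (fun j => x (σ j)) = G x := by
    intro x σ
    simp only [hG]
    exact Equiv.sum_comp (Equiv.mulLeft σ) fun π : Equiv.Perm (Fin n) => g (fun j => x (π j))
  have hGlip : ∀ x y, |G x - G y| ≤
      N * (L * Real.sqrt (2 * |(signSum x : ℝ) - signSum y|)) := by
    intro x y
    obtain ⟨σ, hσ⟩ := exists_perm_sum_sq_le x y
    rw [← hGinv x σ]
    simp only [hG]
    rw [← Finset.sum_sub_distrib]
    refine (Finset.abs_sum_le_sum_abs _ _).trans ?_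
    calc _ ≤ ∑ π : Equiv.Perm (Fin n), L * Real.sqrt (2 * |(signSum x : ℝ) - signSum y|) := by
          refine Finset.sum_le_sum fun π _ => (hg _ _).trans ?_
          refine mul_le_mul_of_nonneg_left (Real.sqrt_le_sqrt ?_) hL
          rw [Equiv.sum_comp π fun j => ((boolSign (x (σ j)) : ℝ) - boolSign (y j)) ^ 2]
          exact hσ
      _ = _ := by rw [Finset.sum_const, nsmul_eq_mul, Finset.card_univ, ← hN]
  have hw1 := sum_iidWeight n s
  have hu1 := sum_layerWeight hne
  have hw0 := iidWeight_nonneg (n := n) hε hn hs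
  have hu0 := layerWeight_nonneg (n := n) s
  -- c is chosen so that √(2T) ≤ T/c + c/2 gives exactly c at T = √n + 1, the bound for the mean of
  -- |sum - s| + 1.
  set c := Real.sqrt (2 * (Real.sqrt n + 1)) with hc
  have hc0 : 0 < c := Real.sqrt_pos.2 (by positivity)
  have hcc : c ^ 2 = 2 * (Real.sqrt n + 1) := Real.sq_sqrt (by positivity)
  have hpair : ∀ x y, layerWeight n s y * |G x - G y| ≤
      layerWeight n s y * (N * (L * ((1 / c) * (|(signSum x : ℝ) - s| + 1) + c / 2))) := by
    intro x y
    by_cases hy : y ∈ layer n s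
    · refine mul_le_mul_of_nonneg_left ((hGlip x y).trans ?_) (hu0 y)
      refine mul_le_mul_of_nonneg_left (mul_le_mul_of_nonneg_left ?_ hL) hN0.le
      have h1 : |(signSum x : ℝ) - signSum y| ≤ |(signSum x : ℝ) - s| + 1 := by
        have h2 : |(s : ℝ) - signSum y| = 1 := by
          rcases mem_layer.1 hy with h | h <;> rw [h] <;> push_cast <;> simp
        calc _ ≤ |(signSum x : ℝ) - s| + |(s : ℝ) - signSum y| := abs_sub_le _ _ _
          _ = _ := by rw [h2]
      set t := |(signSum x : ℝ) - s| + 1 with ht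
      have ht0 : 0 ≤ t := by positivity
      calc _ ≤ Real.sqrt (2 * t) := Real.sqrt_le_sqrt (by linarith)
        _ ≤ 1 / c * t + c / 2 := by
          rw [Real.sqrt_le_left (by positivity)]
          have : (1 / c * t + c / 2) ^ 2 - 2 * t = (1 / c * t - c / 2) ^ 2 := by
            field_simp; ring
          nlinarith [sq_nonneg (1 / c * t - c / 2)]
    · simp [layerWeight, hy]
  have hmain : N * |∑ x, iidWeight n s x * g x - ∑ x, layerWeight n s x * g x| ≤ N * (L * c) := by
    rw [← abs_of_pos hN0, ← abs_mul, abs_of_pos hN0, mul_sub, ← hsym _ (iidWeight_comp_perm s),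
      ← hsym _ (layerWeight_comp_perm s)]
    have e1 : ∑ x, iidWeight n s x * G x - ∑ x, layerWeight n s x * G x =
        ∑ x, iidWeight n s x * ∑ y, layerWeight n s y * (G x - G y) := by
      simp only [mul_sub, Finset.sum_sub_distrib, ← Finset.sum_mul, hw1, hu1, one_mul]
    rw [e1]
    calc _ ≤ ∑ x, iidWeight n s x * ∑ y, layerWeight n s y * |G x - G y| := by
          refine (Finset.abs_sum_le_sum_abs _ _).trans (Finset.sum_le_sum fun x _ => ?_)
          rw [abs_mul, abs_of_nonneg (hw0 x)]
          refine mul_le_mul_of_nonneg_left ?_ (hw0 x)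
          refine (Finset.abs_sum_le_sum_abs _ _).trans (Finset.sum_le_sum fun y _ => ?_)
          rw [abs_mul, abs_of_nonneg (hu0 y)]
      _ ≤ ∑ x, iidWeight n s x * ∑ y, layerWeight n s y *
            (N * (L * ((1 / c) * (|(signSum x : ℝ) - s| + 1) + c / 2))) :=
          Finset.sum_le_sum fun x _ => mul_le_mul_of_nonneg_left
            (Finset.sum_le_sum fun y _ => hpair x y) (hw0 x)
      _ = N * (L * ((1 / c) * (∑ x, iidWeight n s x * |(signSum x : ℝ) - s| + 1) + c / 2)) := by
          simp only [← Finset.sum_mul, hu1, one_mul]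
          have : ∀ x, iidWeight n s x *
              (N * (L * ((1 / c) * (|(signSum x : ℝ) - s| + 1) + c / 2))) =
              N * L * (1 / c) * (iidWeight n s x * |(signSum x : ℝ) - s|) +
              (N * L * (1 / c) + N * L * (c / 2)) * iidWeight n s x := by
            intro x; ring
          simp only [this, Finset.sum_add_distrib, ← Finset.mul_sum, hw1]
          ring
      _ ≤ N * (L * ((1 / c) * (Real.sqrt n + 1) + c / 2)) := by
          have := sum_iidWeight_mul_abs_le hε hn hs
          gcongr
      _ = N * (L * c) := by
          have : Real.sqrt n + 1 = c ^ 2 / 2 := by linarith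
          rw [this]
          field_simp
          ring
  exact le_of_mul_le_mul_left hmain hN0

end RowLaws

/-! ### Density of the fixed-sum law relative to the Bernoulli law -/

section Transfer

variable {n : ℕ}

theorem iidWeight_eq (s : ℤ) (x : Fin n → Bool) : iidWeight n s x =
    bitWeight n s true ^ onesCount x * bitWeight n s false ^ (n - onesCount x) := by
  have h : ∀ j, bitWeight n s (x j) =
      if x j = true then bitWeight n s true else bitWeight n s false := by
    intro j; cases x j <;> simp
  unfold iidWeight
  simp_rw [h]
  rw [Finset.prod_ite, Finset.prod_const, Finset.prod_const]
  congr 2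
  have := Finset.card_filter_add_card_filter_not (s := (Finset.univ : Finset (Fin n)))
    (fun j => x j = true)
  rw [Finset.card_univ, Fintype.card_fin] at this
  unfold onesCount
  omega

theorem card_onesCount_eq (k : ℕ) :
    (Finset.univ.filter fun x : Fin n → Bool => onesCount x = k).card = n.choose k := by
  have : (Finset.powersetCard k (Finset.univ : Finset (Fin n))).card = n.choose k := by
    rw [Finset.card_powersetCard, Finset.card_univ, Fintype.card_fin]
  rw [← this]
  refine Finset.card_nbij' (fun x => Finset.univ.filter fun j => x j = true)
    (fun A j => decide (j ∈ A)) ?_ ?_ ?_ ?_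
  · intro x hx
    rw [Finset.mem_coe, Finset.mem_filter] at hx
    simpa [onesCount, Finset.mem_powersetCard] using hx.2
  · intro A hA
    rw [Finset.mem_coe, Finset.mem_powersetCard] at hA
    rw [Finset.mem_coe, Finset.mem_filter]
    simpa [onesCount] using hA.2
  · intro x _
    ext j; simp
  · intro A _
    ext j; simp

/-- The largest binomial probability is attained next to the mean. -/
theorem binomial_le_of_mean {p q : ℝ} (hp : 0 ≤ p) (hq : 0 < q) (hpq : p + q = 1) {j : ℕ}
    (hj : n * p = j + 1 / 2) (hjn : j < n) {i : ℕ} (hi : i ≤ n) :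
    (n.choose i : ℝ) * p ^ i * q ^ (n - i) ≤ (n.choose j : ℝ) * p ^ j * q ^ (n - j) +
      (n.choose (j + 1) : ℝ) * p ^ (j + 1) * q ^ (n - (j + 1)) := by
  set b : ℕ → ℝ := fun i => (n.choose i : ℝ) * p ^ i * q ^ (n - i) with hb
  have hb0 : ∀ i, 0 ≤ b i := fun i => by positivity
  -- Consecutive binomial weights have ratio (n - i)p / ((i + 1)q), which is at least 1 exactly when
  -- i + q ≤ np = j + 1/2.
  have hstep : ∀ i, i < n → b (i + 1) * ((i + 1) * q) = b i * ((n - i) * p) := by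
    intro i hi
    have h1 : (n.choose (i + 1) : ℝ) * (i + 1) = n.choose i * (n - i) := by
      have := Nat.choose_succ_right_eq n i
      have h2 : ((n.choose (i + 1) * (i + 1) : ℕ) : ℝ) = ((n.choose i * (n - i) : ℕ) : ℝ) := by
        rw [this]
      push_cast [Nat.cast_sub hi.le] at h2
      exact h2
    have h3 : n - i = (n - (i + 1)) + 1 := by omega
    simp only [hb]
    rw [h3, pow_succ, pow_succ]
    linear_combination p ^ i * p * q ^ (n - (i + 1)) * q * h1
  have hup : ∀ i, i < j → b i ≤ b (i + 1) := by
    intro i hi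
    have h1 := hstep i (by omega)
    have hij : (i : ℝ) + 1 ≤ j := by exact_mod_cast hi
    have h2 : ((i : ℝ) + 1) * q ≤ (n - i) * p := by nlinarith
    have h3 : 0 < ((i : ℝ) + 1) * q := by positivity
    refine le_of_mul_le_mul_right ?_ h3
    rw [h1]
    exact mul_le_mul_of_nonneg_left h2 (hb0 i)
  have hdown : ∀ i, j + 1 ≤ i → i < n → b (i + 1) ≤ b i := by
    intro i hi hin
    have h1 := hstep i hin
    have hij : (j : ℝ) + 1 ≤ i := by exact_mod_cast hi
    have h2 : (n - i : ℝ) * p ≤ (i + 1) * q := by nlinarith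
    have h3 : 0 < ((i : ℝ) + 1) * q := by positivity
    refine le_of_mul_le_mul_right ?_ h3
    rw [h1]
    exact mul_le_mul_of_nonneg_left h2 (hb0 i)
  have hup' : ∀ d, d ≤ j → b (j - d) ≤ b j := by
    intro d hd
    induction d with
    | zero => simp
    | succ d ih =>
      refine le_trans ?_ (ih (by omega))
      have := hup (j - (d + 1)) (by omega)
      rwa [show j - (d + 1) + 1 = j - d by omega] at this
  have hdown' : ∀ d, j + 1 + d ≤ n → b (j + 1 + d) ≤ b (j + 1) := by
    intro d hd
    induction d with
    | zero => simp
    | succ d ih => exact (hdown (j + 1 + d) (by omega) (by omega)).trans (ih (by omega))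
  change b i ≤ b j + b (j + 1)
  rcases le_or_gt i j with h | h
  · have := hup' (j - i) (by omega)
    rw [show j - (j - i) = i by omega] at this
    linarith [hb0 (j + 1)]
  · have := hdown' (i - (j + 1)) (by omega)
    rw [show j + 1 + (i - (j + 1)) = i by omega] at this
    linarith [hb0 j]

/-- The Bernoulli row falls in the layers with probability at least `1 / (n + 1)`. -/
theorem one_le_mul_sum_layer {ε : ℝ} (hε : 0 < ε) (hn : 0 < n) {s : ℤ}
    (hs : |(s : ℝ)| ≤ (1 - ε) * n) (hne : (layer n s).Nonempty) :
    1 ≤ (n + 1 : ℝ) * ∑ x ∈ layer n s, iidWeight n s x := by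
  have hn' : (0 : ℝ) < n := by exact_mod_cast hn
  have hslt : |s| < (n : ℤ) := by
    have : |(s : ℝ)| < n := by nlinarith
    exact_mod_cast this
  obtain ⟨hs1, hs2⟩ := abs_lt.1 hslt
  -- A vector in the layer forces n + s to be odd. The layer then consists of the levels with j and
  -- j + 1 ones, on either side of the mean j + 1/2.
  obtain ⟨j, hj⟩ : ∃ j : ℕ, (n : ℤ) + s = 2 * j + 1 := by
    obtain ⟨x, hx⟩ := hne
    have h1 := signSum_eq x
    refine ⟨(((n : ℤ) + s) / 2).toNat, ?_⟩
    rcases mem_layer.1 hx with h | h <;> omega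
  have hjn : j < n := by omega
  set p := bitWeight n s true with hp
  set q := bitWeight n s false with hq
  have hp0 : 0 ≤ p := bitWeight_nonneg hε hn hs _
  have hq0 : 0 < q := lt_of_lt_of_le (by linarith) (half_le_bitWeight hn hs false)
  have hpq : p + q = 1 := by simpa using sum_bitWeight n s
  have hmean : n * p = j + 1 / 2 := by
    have h1 : (n : ℝ) + s = 2 * j + 1 := by exact_mod_cast hj
    have h2 : (n : ℝ) * p = (n + s) / 2 := by
      rw [hp]; simp [bitWeight, boolSign]; field_simp
    rw [h2, h1]; ring
  have hlevel : ∀ k, ∑ x ∈ Finset.univ.filter (fun x : Fin n → Bool => onesCount x = k),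
      iidWeight n s x = (n.choose k : ℝ) * p ^ k * q ^ (n - k) := by
    intro k
    rw [← card_onesCount_eq, mul_assoc, ← nsmul_eq_mul, ← Finset.sum_const]
    refine Finset.sum_congr rfl fun x hx => ?_
    rw [iidWeight_eq, (Finset.mem_filter.1 hx).2]
  have hlayer : layer n s = (Finset.univ.filter fun x : Fin n → Bool => onesCount x = j) ∪
      (Finset.univ.filter fun x : Fin n → Bool => onesCount x = j + 1) := by
    ext x
    rw [mem_layer, Finset.mem_union, Finset.mem_filter, Finset.mem_filter, signSum_eq]
    simp only [Finset.mem_univ, true_and]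
    omega
  have hdisj : Disjoint (Finset.univ.filter fun x : Fin n → Bool => onesCount x = j)
      (Finset.univ.filter fun x : Fin n → Bool => onesCount x = j + 1) := by
    rw [Finset.disjoint_left]
    intro x hx hx'
    have h1 := (Finset.mem_filter.1 hx).2
    have h2 := (Finset.mem_filter.1 hx').2
    omega
  rw [hlayer, Finset.sum_union hdisj, hlevel, hlevel]
  have hbin := add_pow p q n
  rw [hpq, one_pow] at hbin
  calc (1 : ℝ) = ∑ i ∈ Finset.range (n + 1), p ^ i * q ^ (n - i) * (n.choose i : ℝ) := hbin
    _ ≤ ∑ i ∈ Finset.range (n + 1), ((n.choose j : ℝ) * p ^ j * q ^ (n - j) +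
          (n.choose (j + 1) : ℝ) * p ^ (j + 1) * q ^ (n - (j + 1))) := by
        refine Finset.sum_le_sum fun i hi => ?_
        rw [Finset.mem_range] at hi
        refine le_trans (le_of_eq (by ring)) (binomial_le_of_mean hp0 hq0 hpq hmean hjn
          (show i ≤ n by omega))
    _ = _ := by
        rw [Finset.sum_const, Finset.card_range, nsmul_eq_mul]; push_cast; ring

/-- Numbers of ones in the layer differ by at most one, so the weights differ by a factor at most
p/q or q/p, and p, q lie in [ε/2, 1]. -/
theorem half_mul_iidWeight_le {ε : ℝ} (hε : 0 < ε) (hε1 : ε ≤ 1) (hn : 0 < n) {s : ℤ}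
    (hs : |(s : ℝ)| ≤ (1 - ε) * n) {x y : Fin n → Bool} (hx : x ∈ layer n s)
    (hy : y ∈ layer n s) : ε / 2 * iidWeight n s y ≤ iidWeight n s x := by
  have hp := half_le_bitWeight hn hs true
  have hq := half_le_bitWeight hn hs false
  have hpq : bitWeight n s true + bitWeight n s false = 1 := by simpa using sum_bitWeight n s
  have hwx := iidWeight_nonneg hε hn hs x
  have hwy := iidWeight_nonneg hε hn hs y
  rw [mem_layer, signSum_eq] at hx hy
  have hxn := onesCount_le x
  have hyn := onesCount_le y
  have hcase : onesCount y = onesCount x ∨ onesCount y = onesCount x + 1 ∨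
      onesCount x = onesCount y + 1 := by omega
  rcases hcase with h | h | h
  · have : iidWeight n s y = iidWeight n s x := by rw [iidWeight_eq, iidWeight_eq, h]
    rw [this]; nlinarith
  · have : iidWeight n s y * bitWeight n s false = iidWeight n s x * bitWeight n s true := by
      rw [iidWeight_eq, iidWeight_eq, h, show n - onesCount x = n - (onesCount x + 1) + 1 by omega]
      ring
    nlinarith
  · have : iidWeight n s y * bitWeight n s true = iidWeight n s x * bitWeight n s false := by
      rw [iidWeight_eq, iidWeight_eq, h, show n - onesCount y = n - (onesCount y + 1) + 1 by omega]
      ring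
    nlinarith

/-- The law of a row of given sum has a polynomially bounded density with respect to the law of a
Bernoulli row. -/
theorem layerWeight_le {ε : ℝ} (hε : 0 < ε) (hε1 : ε ≤ 1) (hn : 0 < n) {s : ℤ}
    (hs : |(s : ℝ)| ≤ (1 - ε) * n) (hne : (layer n s).Nonempty) (x : Fin n → Bool) :
    layerWeight n s x ≤ 2 / ε * (n + 1) * iidWeight n s x := by
  have hw := iidWeight_nonneg hε hn hs x
  by_cases hx : x ∈ layer n s
  · rw [layerWeight, if_pos hx]
    have hU : (0 : ℝ) < (layer n s).card := by exact_mod_cast hne.card_pos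
    rw [div_le_iff₀ hU]
    have h1 := one_le_mul_sum_layer hε hn hs hne
    have h2 : ∑ y ∈ layer n s, iidWeight n s y ≤ (layer n s).card * (2 / ε * iidWeight n s x) := by
      rw [← nsmul_eq_mul]
      refine Finset.sum_le_card_nsmul _ _ _ fun y hy => ?_
      have := half_mul_iidWeight_le hε hε1 hn hs hx hy
      rw [div_mul_eq_mul_div, le_div_iff₀ hε]
      linarith
    calc (1 : ℝ) ≤ _ := h1
      _ ≤ (n + 1) * ((layer n s).card * (2 / ε * iidWeight n s x)) := by gcongr
      _ = _ := by ring
  · rw [layerWeight, if_neg hx]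
    positivity

end Transfer

/-! ### Concentration of the volume for a matrix with independent rows -/

section BitMatrix

variable {n : ℕ}

/-- The sign matrix coded by `a`. -/
def bitMatrix (a : Fin n → Fin n → Bool) : Matrix (Fin n) (Fin n) ℤ :=
  Matrix.of fun i j => boolSign (a i j)

/-- The deterministic part of the `i`-th row of the shifted matrix. -/
noncomputable def rowShift (f : Fin n → ℤ) (z : ℂ) (i : Fin n) : EuclideanSpace ℂ (Fin n) :=
  WithLp.toLp 2 (fun j => (f j : ℂ)) - (z * (Real.sqrt n : ℂ)) • EuclideanSpace.single i (1 : ℂ)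

theorem rowVec_shiftedMatrix (f : Fin n → ℤ) (z : ℂ) (a : Fin n → Fin n → Bool) (i : Fin n) :
    rowVec (shiftedMatrix f z (bitMatrix a)) i = signRow (a i) + rowShift f z i := by
  ext j
  simp [rowVec, shiftedMatrix, bitMatrix, signRow, rowShift, Matrix.one_apply, eq_comm,
    add_sub_assoc]

theorem norm_sq_toLp_sign {v : Fin n → ℤ} (hv : ∀ j, v j = 1 ∨ v j = -1) :
    ‖(WithLp.toLp 2 (fun j => (v j : ℂ)) : EuclideanSpace ℂ (Fin n))‖ ^ 2 = n := by
  rw [EuclideanSpace.norm_sq_eq]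
  have : ∀ j, ‖((v j : ℤ) : ℂ)‖ ^ 2 = 1 := by
    intro j
    rcases hv j with h | h <;> simp [h]
  rw [Finset.sum_congr rfl fun j _ => this j]
  simp

theorem boolSign_eq (b : Bool) : boolSign b = 1 ∨ boolSign b = -1 := by
  cases b <;> simp [boolSign]

theorem norm_signRow (x : Fin n → Bool) : ‖signRow x‖ = Real.sqrt n := by
  rw [← norm_sq_toLp_sign (v := fun j => boolSign (x j)) fun j => boolSign_eq (x j),
    Real.sqrt_sq (norm_nonneg _)]
  rfl

theorem norm_signRow_sub (x y : Fin n → Bool) : ‖signRow x - signRow y‖ =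
    Real.sqrt (∑ j, ((boolSign (x j) : ℝ) - boolSign (y j)) ^ 2) := by
  rw [EuclideanSpace.norm_eq]
  congr 1
  refine Finset.sum_congr rfl fun j _ => ?_
  have : (signRow x - signRow y) j = (((boolSign (x j) : ℝ) - boolSign (y j) : ℝ) : ℂ) := by
    simp [signRow]
  rw [this, Complex.norm_real, Real.norm_eq_abs, sq_abs]

theorem norm_rowVec_sq_le {f : Fin n → ℤ} (hf : ∀ j, f j = 1 ∨ f j = -1) (z : ℂ)
    (a : Fin n → Fin n → Bool) (i : Fin n) :
    ‖rowVec (shiftedMatrix f z (bitMatrix a)) i‖ ^ 2 ≤ (2 + ‖z‖) ^ 2 * n := by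
  have h1 : ‖(WithLp.toLp 2 (fun j => (f j : ℂ)) : EuclideanSpace ℂ (Fin n))‖ = Real.sqrt n := by
    rw [← norm_sq_toLp_sign hf, Real.sqrt_sq (norm_nonneg _)]
  have h2 : ‖rowVec (shiftedMatrix f z (bitMatrix a)) i‖ ≤ (2 + ‖z‖) * Real.sqrt n := by
    rw [rowVec_shiftedMatrix, rowShift]
    refine (norm_add_le _ _).trans ?_
    rw [norm_signRow]
    have h3 := norm_sub_le (WithLp.toLp 2 (fun j => (f j : ℂ)) : EuclideanSpace ℂ (Fin n))
      ((z * (Real.sqrt n : ℂ)) • EuclideanSpace.single i (1 : ℂ))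
    rw [h1, norm_smul, norm_mul, Complex.norm_real, Real.norm_of_nonneg (Real.sqrt_nonneg _)] at h3
    have h4 : ‖(EuclideanSpace.single i (1 : ℂ) : EuclideanSpace ℂ (Fin n))‖ = 1 := by simp
    rw [h4] at h3
    linarith
  calc _ ≤ ((2 + ‖z‖) * Real.sqrt n) ^ 2 := pow_le_pow_left₀ (norm_nonneg _) h2 2
    _ = _ := by rw [mul_pow, Real.sq_sqrt (Nat.cast_nonneg n)]

theorem rowVec_shiftedMatrix_update_of_ne (f : Fin n → ℤ) (z : ℂ) (a : Fin n → Fin n → Bool)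
    {i j : Fin n} (h : j ≠ i) (b : Fin n → Bool) :
    rowVec (shiftedMatrix f z (bitMatrix (Function.update a i b))) j =
      rowVec (shiftedMatrix f z (bitMatrix a)) j := by
  rw [rowVec_shiftedMatrix, rowVec_shiftedMatrix, Function.update_of_ne h]

/-- The regularized log-determinant of the first `m` rows of the shifted matrix. -/
noncomputable def rowLogDet (τ : ℝ) (m : ℕ) (f : Fin n → ℤ) (z : ℂ) (a : Fin n → Fin n → Bool) :
    ℝ :=
  regLogDet τ (rowVec (shiftedMatrix f z (bitMatrix a))) (firstRows n m)

theorem abs_rowLogDet_update_sub_le {τ : ℝ} (hτ : 0 < τ) (m : ℕ) (f : Fin n → ℤ) (z : ℂ)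
    (a : Fin n → Fin n → Bool) (i : Fin n) (b b' : Fin n → Bool) :
    |rowLogDet τ m f z (Function.update a i b) - rowLogDet τ m f z (Function.update a i b')| ≤
      2 / Real.sqrt τ * Real.sqrt (∑ j, ((boolSign (b j) : ℝ) - boolSign (b' j)) ^ 2) := by
  refine (abs_regLogDet_sub_le hτ _ i fun j hj => ?_).trans (le_of_eq ?_)
  · rw [rowVec_shiftedMatrix_update_of_ne f z a hj, rowVec_shiftedMatrix_update_of_ne f z a hj]
  · rw [rowVec_shiftedMatrix, rowVec_shiftedMatrix, Function.update_self, Function.update_self,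
      add_sub_add_right_eq_sub, norm_signRow_sub]
    ring

theorem abs_rowLogDet_update_sub_self_le {τ : ℝ} (hτ : 0 < τ) (m : ℕ) (f : Fin n → ℤ) (z : ℂ)
    (a : Fin n → Fin n → Bool) (i : Fin n) (b : Fin n → Bool) :
    |rowLogDet τ m f z (Function.update a i b) - rowLogDet τ m f z a| ≤
      4 * Real.sqrt n / Real.sqrt τ := by
  have h := abs_rowLogDet_update_sub_le hτ m f z a i b (a i)
  rw [Function.update_eq_self, ← norm_signRow_sub] at h
  have h1 := norm_sub_le (signRow b) (signRow (a i))
  rw [norm_signRow, norm_signRow] at h1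
  have hs := Real.sqrt_pos.2 hτ
  calc _ ≤ 2 / Real.sqrt τ * ‖signRow b - signRow (a i)‖ := h
    _ ≤ 2 / Real.sqrt τ * (Real.sqrt n + Real.sqrt n) := by gcongr
    _ = _ := by ring

/-- The expected regularized log-determinants of the two models are close. -/
theorem abs_prodExp_rowLogDet_sub_le {ε : ℝ} (hε : 0 < ε) (hn : 0 < n) {s : ℤ}
    (hs : |(s : ℝ)| ≤ (1 - ε) * n) (hne : (layer n s).Nonempty) {τ : ℝ} (hτ : 0 < τ) (m : ℕ)
    (f : Fin n → ℤ) (z : ℂ) :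
    |prodExp (iidWeight n s) (rowLogDet τ m f z) - prodExp (layerWeight n s) (rowLogDet τ m f z)| ≤
      n * (2 / Real.sqrt τ * Real.sqrt (2 * (Real.sqrt n + 1))) :=
  abs_prodExp_sub_prodExp_le (iidWeight_nonneg hε hn hs) (sum_iidWeight n s)
    (layerWeight_nonneg s) (sum_layerWeight hne) fun a i =>
    abs_sum_iidWeight_sub_sum_layerWeight_le hε hn hs hne (by positivity)
      (g := fun b => rowLogDet τ m f z (Function.update a i b))
      fun b b' => abs_rowLogDet_update_sub_le hτ m f z a i b b'

theorem le_finrank_span_image_orthogonal {E ι : Type*} [NormedAddCommGroup E]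
    [InnerProductSpace ℂ E] [FiniteDimensional ℂ E] (r : ι → E) (I : Finset ι) :
    (Module.finrank ℂ E : ℝ) - I.card ≤
      (Module.finrank ℂ (Submodule.span ℂ (r '' I))ᗮ : ℝ) := by
  classical
  have h1 := Submodule.finrank_add_finrank_orthogonal (Submodule.span ℂ (r '' (I : Set ι)))
  have h2 : Module.finrank ℂ (Submodule.span ℂ (r '' (I : Set ι))) ≤ I.card := by
    rw [← Finset.coe_image]
    exact (finrank_span_finset_le_card _).trans Finset.card_image_le
  have h3 : (Module.finrank ℂ E : ℝ) =
      (Module.finrank ℂ (Submodule.span ℂ (r '' (I : Set ι))) : ℝ) +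
      Module.finrank ℂ (Submodule.span ℂ (r '' (I : Set ι)))ᗮ := by exact_mod_cast h1.symm
  have h4 : (Module.finrank ℂ (Submodule.span ℂ (r '' (I : Set ι))) : ℝ) ≤ I.card := by
    exact_mod_cast h2
  linarith

/-- A row of the random matrix is far from the span of a few other rows. -/
theorem prodProb_infDist_rowVec_le {ε : ℝ} (hε : 0 < ε) (hn : 0 < n) {s : ℤ}
    (hs : |(s : ℝ)| ≤ (1 - ε) * n) {w : (Fin n → Bool) → ℝ} (hw : ∀ x, 0 ≤ w x)
    (hw1 : ∑ x, w x = 1) {D : ℝ} (hD : 0 ≤ D) (hwD : ∀ x, w x ≤ D * iidWeight n s x)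
    (f : Fin n → ℤ) (z : ℂ) {i : Fin n} {I : Finset (Fin n)} (hi : i ∉ I) {α k : ℝ}
    (hk : k ≤ n - I.card) :
    prodProb w {a | Metric.infDist (rowVec (shiftedMatrix f z (bitMatrix a)) i)
      (Submodule.span ℂ (rowVec (shiftedMatrix f z (bitMatrix a)) '' I) : Set _) ≤ α} ≤
      D * Real.exp (-((ε / 2 * k - α ^ 2) / 16)) := by
  -- All rows but the i-th are frozen, so the span is a fixed subspace and the density bound D is
  -- paid only once.
  refine prodProb_le_of_resample hw hw1 i fun a => ?_
  set V := Submodule.span ℂ (rowVec (shiftedMatrix f z (bitMatrix a)) '' (I : Set (Fin n))) with hV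
  have hset : ∀ b, Function.update a i b ∈
      {a : Fin n → Fin n → Bool | Metric.infDist (rowVec (shiftedMatrix f z (bitMatrix a)) i)
      (Submodule.span ℂ (rowVec (shiftedMatrix f z (bitMatrix a)) '' I) : Set _) ≤ α} ↔
      b ∈ {b : Fin n → Bool | Metric.infDist (signRow b + rowShift f z i) (V : Set _) ≤ α} := by
    intro b
    have h1 : rowVec (shiftedMatrix f z (bitMatrix (Function.update a i b))) '' (I : Set (Fin n)) =
        rowVec (shiftedMatrix f z (bitMatrix a)) '' (I : Set (Fin n)) :=
      Set.image_congr fun j (hj : j ∈ I) =>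
        rowVec_shiftedMatrix_update_of_ne f z a (fun e => hi (by rwa [← e])) b
    change Metric.infDist _ _ ≤ α ↔ Metric.infDist _ _ ≤ α
    rw [h1, rowVec_shiftedMatrix, Function.update_self]
  calc _ ≤ ∑ b, D * (iidWeight n s b *
        {b : Fin n → Bool | Metric.infDist (signRow b + rowShift f z i) (V : Set _) ≤ α}.indicator
          1 b) := by
        refine Finset.sum_le_sum fun b _ => ?_
        by_cases hb : b ∈ {b : Fin n → Bool |
            Metric.infDist (signRow b + rowShift f z i) (V : Set _) ≤ α}
        · rw [Set.indicator_of_mem hb, Set.indicator_of_mem ((hset b).2 hb)]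
          simpa using hwD b
        · rw [Set.indicator_of_notMem hb, Set.indicator_of_notMem (fun h => hb ((hset b).1 h))]
          simp
    _ = D * prodProb (bitWeight n s)
          {b | Metric.infDist (signRow b + rowShift f z i) (V : Set _) ≤ α} := by
        rw [← Finset.mul_sum, sum_iidWeight_mul]; rfl
    _ ≤ _ := by
        refine mul_le_mul_of_nonneg_left ((prodProb_infDist_le (bitWeight_nonneg hε hn hs)
          (sum_bitWeight n s) V _).trans (Real.exp_le_exp.2 ?_)) hD
        have hp := half_le_bitWeight hn hs true
        have hq := half_le_bitWeight hn hs false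
        have hpq : bitWeight n s true + bitWeight n s false = 1 := by
          simpa using sum_bitWeight n s
        -- One of the two weights is at least 1/2 and the other at least ε/2.
        have h1 : ε / 2 ≤ 2 * (bitWeight n s true * bitWeight n s false) := by
          rcases le_total (bitWeight n s true) (1 / 2) with h | h <;> nlinarith
        have h2 := le_finrank_span_image_orthogonal (rowVec (shiftedMatrix f z (bitMatrix a))) I
        rw [finrank_euclideanSpace_fin] at h2
        have h3 : (0 : ℝ) ≤ Module.finrank ℂ Vᗮ := Nat.cast_nonneg _
        have h4 : ε / 2 * k ≤ 2 * (bitWeight n s true * bitWeight n s false) *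
            (Module.finrank ℂ Vᗮ : ℝ) := by
          calc ε / 2 * k ≤ ε / 2 * (Module.finrank ℂ Vᗮ : ℝ) :=
                mul_le_mul_of_nonneg_left (hk.trans h2) (by positivity)
            _ ≤ _ := mul_le_mul_of_nonneg_right h1 h3
        linarith

/-- The volume of the first `m` rows is positive and concentrated around a deterministic value. -/
theorem prodProb_not_rowVolume_le {ε : ℝ} (hε : 0 < ε) (hn : 0 < n) {s : ℤ}
    (hs : |(s : ℝ)| ≤ (1 - ε) * n) {w : (Fin n → Bool) → ℝ} (hw : ∀ x, 0 ≤ w x)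
    (hw1 : ∑ x, w x = 1) {D : ℝ} (hD : 0 ≤ D) (hwD : ∀ x, w x ≤ D * iidWeight n s x)
    {f : Fin n → ℤ} (hf : ∀ j, f j = 1 ∨ f j = -1) (z : ℂ) {τ α t : ℝ} (hτ : 0 < τ) (hα : 0 < α)
    (ht : 0 ≤ t) {k m : ℕ} (hkm : k ≤ m) (hm : m ≤ n) :
    prodProb w {a | ¬ (0 < rowVolume m (shiftedMatrix f z (bitMatrix a)) ∧
      |2 * Real.log (rowVolume m (shiftedMatrix f z (bitMatrix a))) -
        (prodExp w (rowLogDet τ m f z) + (m - n : ℝ) * Real.log τ)| ≤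
        t + (τ * k / α ^ 2 + (m - k : ℝ) * Real.log (τ + (2 + ‖z‖) ^ 2 * n)))} ≤
      n * (D * Real.exp (-((ε / 2 * (n - k) - α ^ 2) / 16))) +
      n * (D * Real.exp (-((ε / 2 * (n - m) - 1 ^ 2) / 16))) +
      2 * Real.exp (-(t ^ 2 / (2 * n * (4 * Real.sqrt n / Real.sqrt τ) ^ 2))) := by
  set r : (Fin n → Fin n → Bool) → Fin n → EuclideanSpace ℂ (Fin n) :=
    fun a => rowVec (shiftedMatrix f z (bitMatrix a)) with hr
  set B1 : Fin n → Set (Fin n → Fin n → Bool) := fun i => {a | i ∈ firstRows n k ∧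
    Metric.infDist (r a i) (Submodule.span ℂ (r a '' ((firstRows n k).erase i)) : Set _) ≤ α}
    with hB1
  set B2 : Fin n → Set (Fin n → Fin n → Bool) := fun i => {a | i ∈ firstRows n m ∧
    Metric.infDist (r a i) (Submodule.span ℂ (r a '' (firstRows n i)) : Set _) ≤ 1} with hB2
  set B3 : Set (Fin n → Fin n → Bool) :=
    {a | t ≤ |rowLogDet τ m f z a - prodExp w (rowLogDet τ m f z)|} with hB3
  have hsub : {a | ¬ (0 < rowVolume m (shiftedMatrix f z (bitMatrix a)) ∧
      |2 * Real.log (rowVolume m (shiftedMatrix f z (bitMatrix a))) -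
        (prodExp w (rowLogDet τ m f z) + (m - n : ℝ) * Real.log τ)| ≤
        t + (τ * k / α ^ 2 + (m - k : ℝ) * Real.log (τ + (2 + ‖z‖) ^ 2 * n)))} ⊆
      (⋃ i, B1 i) ∪ (⋃ i, B2 i) ∪ B3 := by
    intro a ha
    by_contra hcon
    rw [Set.mem_union, Set.mem_union, not_or, not_or, Set.mem_iUnion, Set.mem_iUnion,
      not_exists, not_exists] at hcon
    obtain ⟨⟨h1, h2⟩, h3⟩ := hcon
    refine ha ?_
    have h3' : |rowLogDet τ m f z a - prodExp w (rowLogDet τ m f z)| < t := not_le.1 h3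
    obtain ⟨h4, h5⟩ := rowVolume_pos_and_abs_log_sub_le hτ hα hkm hm
      (shiftedMatrix f z (bitMatrix a)) (K := τ + (2 + ‖z‖) ^ 2 * n)
      (fun i => add_le_add le_rfl (norm_rowVec_sq_le hf z a i))
      (fun i hi => le_of_lt (not_le.1 fun h => h1 i ⟨hi, h⟩))
      (fun i hi _ => le_of_lt (not_le.1 fun h => h2 i ⟨hi, h⟩))
    refine ⟨h4, ?_⟩
    have h6 : regLogDet τ (rowVec (shiftedMatrix f z (bitMatrix a))) (firstRows n m) =
        rowLogDet τ m f z a := rfl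
    rw [h6] at h5
    have h7 := abs_le.1 h5
    have h8 := abs_lt.1 h3'
    rw [abs_le]
    constructor <;> linarith [h7.1, h7.2, h8.1, h8.2]
  refine (prodProb_mono hw hsub).trans ((prodProb_union_le hw _ _).trans (add_le_add
    ((prodProb_union_le hw _ _).trans (add_le_add ?_ ?_)) ?_))
  · refine (prodProb_iUnion_le hw _).trans ?_
    calc _ ≤ ∑ _i : Fin n, D * Real.exp (-((ε / 2 * (n - k) - α ^ 2) / 16)) := by
          refine Finset.sum_le_sum fun i _ => ?_
          by_cases hi : i ∈ firstRows n k
          · refine (prodProb_mono hw fun a ha => ?_).trans (prodProb_infDist_rowVec_le hε hn hs hw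
              hw1 hD hwD f z (Finset.notMem_erase i (firstRows n k)) ?_)
            · exact ha.2
            · rw [sub_le_sub_iff_left]
              exact_mod_cast (Finset.card_le_card (Finset.erase_subset _ _)).trans
                (card_firstRows (hkm.trans hm)).le
          · refine (prodProb_mono hw (T := ∅) fun a ha => hi ha.1).trans ?_
            have : prodProb w (∅ : Set (Fin n → Fin n → Bool)) = 0 := by
              simp [prodProb, prodExp]
            rw [this]
            positivity
      _ = _ := by simp
  · refine (prodProb_iUnion_le hw _).trans ?_
    calc _ ≤ ∑ _i : Fin n, D * Real.exp (-((ε / 2 * (n - m) - 1 ^ 2) / 16)) := by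
          refine Finset.sum_le_sum fun i _ => ?_
          by_cases hi : i ∈ firstRows n m
          · refine (prodProb_mono hw fun a ha => ?_).trans (prodProb_infDist_rowVec_le hε hn hs hw
              hw1 hD hwD f z (i := i) (I := firstRows n i) (by simp [mem_firstRows]) ?_)
            · exact ha.2
            · rw [sub_le_sub_iff_left, card_firstRows i.2.le]
              exact_mod_cast (mem_firstRows.1 hi).le
          · refine (prodProb_mono hw (T := ∅) fun a ha => hi ha.1).trans ?_
            have : prodProb w (∅ : Set (Fin n → Fin n → Bool)) = 0 := by
              simp [prodProb, prodExp]
            rw [this]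
            positivity
      _ = _ := by simp
  · have hn' : (0 : ℝ) < n := by exact_mod_cast hn
    exact prodProb_abs_sub_ge_le hw hw1 hn
      (div_pos (mul_pos four_pos (Real.sqrt_pos.2 hn')) (Real.sqrt_pos.2 hτ)) ht
      fun a i b => abs_rowLogDet_update_sub_self_le hτ m f z a i b

end BitMatrix

/-! ### From the random matrices to weights on Boolean matrices -/

section Laws

variable {n : ℕ} {Ω : Type*} [MeasurableSpace Ω] {P : Measure Ω} [IsProbabilityMeasure P]

/-- Probabilities of events on sign matrices are bounded by means of the weights of the rows. -/
theorem measureReal_le_prodProb {X : Ω → Matrix (Fin n) (Fin n) ℤ} {w : (Fin n → Bool) → ℝ}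
    (h0 : ∀ i j, ∀ᵐ ω ∂P, X ω i j = 1 ∨ X ω i j = -1)
    (h : ∀ a : Fin n → Fin n → Bool, P.real {ω | X ω = bitMatrix a} ≤ ∏ i, w (a i))
    (S : Set (Matrix (Fin n) (Fin n) ℤ)) :
    P.real {ω | X ω ∈ S} ≤ prodProb w {a | bitMatrix a ∈ S} := by
  classical
  have h1 : ∀ᵐ ω ∂P, ∀ i j, X ω i j = 1 ∨ X ω i j = -1 :=
    ae_all_iff.2 fun i => ae_all_iff.2 fun j => h0 i j
  have hnull : P.real {ω | ¬ ∀ i j, X ω i j = 1 ∨ X ω i j = -1} = 0 := by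
    rw [measureReal_eq_zero_iff]
    exact ae_iff.1 h1
  -- Outside a null set each realization is coded by a Boolean matrix. Only monotonicity and
  -- subadditivity are used afterwards, so the event need not be measurable.
  have hsub : {ω | X ω ∈ S} ⊆ {ω | ¬ ∀ i j, X ω i j = 1 ∨ X ω i j = -1} ∪
      ⋃ a : Fin n → Fin n → Bool, {ω | bitMatrix a ∈ S ∧ X ω = bitMatrix a} := by
    intro ω hω
    by_cases hb : ∀ i j, X ω i j = 1 ∨ X ω i j = -1
    · refine Or.inr (Set.mem_iUnion.2 ⟨fun i j => decide (X ω i j = 1), ?_⟩)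
      have : X ω = bitMatrix fun i j => decide (X ω i j = 1) := by
        ext i j
        rcases hb i j with h | h <;> simp [bitMatrix, boolSign, h]
      exact ⟨by rw [← this]; exact hω, this⟩
    · exact Or.inl hb
  refine (measureReal_mono hsub).trans ((measureReal_union_le _ _).trans ?_)
  rw [hnull, zero_add]
  refine (measureReal_iUnion_fintype_le _).trans (Finset.sum_le_sum fun a _ => ?_)
  by_cases ha : bitMatrix a ∈ S
  · rw [Set.indicator_of_mem (by exact ha), Pi.one_apply, mul_one]
    exact (measureReal_mono fun ω hω => hω.2).trans (h a)
  · rw [Set.indicator_of_notMem (by exact ha), mul_zero]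
    have : {ω | bitMatrix a ∈ S ∧ X ω = bitMatrix a} = ∅ := by
      ext ω
      exact ⟨fun h => ha h.1, fun h => h.elim⟩
    rw [this, measureReal_empty]

theorem coe_image_layer (n : ℕ) (s : ℤ) [DecidableEq (Fin n → ℤ)] :
    (((layer n s).image fun x j => boolSign (x j) : Finset (Fin n → ℤ)) : Set (Fin n → ℤ)) =
      signVectors n s := by
  ext v
  rw [Finset.mem_coe, Finset.mem_image]
  constructor
  · rintro ⟨x, hx, rfl⟩
    exact ⟨fun j => boolSign_eq _, mem_layer.1 hx⟩
  · rintro ⟨h1, h2⟩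
    have e : (fun j => boolSign (decide (v j = 1))) = v := by
      ext j
      rcases h1 j with h | h <;> simp [boolSign, h]
    refine ⟨fun j => decide (v j = 1), mem_layer.2 ?_, e⟩
    unfold signSum
    rw [Finset.sum_congr rfl fun j _ => congrFun e j]
    exact h2

theorem boolSign_injective : Function.Injective boolSign := by
  intro a b h
  cases a <;> cases b <;> simp_all [boolSign]

theorem uniformOn_signVectors_real_singleton (s : ℤ) (x : Fin n → Bool) :
    (uniformOn (signVectors n s)).real {fun j => boolSign (x j)} = layerWeight n s x := by
  classical
  have hinj : Function.Injective fun (x : Fin n → Bool) j => boolSign (x j) := fun x y h =>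
    funext fun j => boolSign_injective (congrFun h j)
  rw [Measure.real, ← coe_image_layer, ← Finset.coe_singleton, uniformOn_apply_finset,
    Finset.card_image_of_injective _ hinj, layerWeight]
  by_cases hx : x ∈ layer n s
  · rw [if_pos hx, Finset.inter_singleton_of_mem (Finset.mem_image_of_mem _ hx)]
    simp
  · rw [if_neg hx, Finset.inter_singleton_of_notMem]
    · simp
    · intro hm
      obtain ⟨y, hy, hyx⟩ := Finset.mem_image.1 hm
      exact hx (hinj hyx ▸ hy)

/-- Here the parity condition on s enters: the uniform law on an empty set is the zero measure,
which cannot be the law of a row. -/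
theorem IsRowSumMatrix.layer_nonempty (hn : 0 < n) {s : ℤ}
    {X : Ω → Matrix (Fin n) (Fin n) ℤ} (hX : IsRowSumMatrix P n s X) : (layer n s).Nonempty := by
  classical
  by_contra hcon
  rw [Finset.not_nonempty_iff_eq_empty] at hcon
  have h := (hX.law ⟨0, hn⟩).isProbabilityMeasure_iff.1 inferInstance
  rw [← coe_image_layer, hcon, Finset.image_empty, Finset.coe_empty, uniformOn_empty_meas] at h
  exact h.ne_zero _ rfl

theorem IsRowSumMatrix.measureReal_le {s : ℤ} {X : Ω → Matrix (Fin n) (Fin n) ℤ}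
    (hX : IsRowSumMatrix P n s X) (S : Set (Matrix (Fin n) (Fin n) ℤ)) :
    P.real {ω | X ω ∈ S} ≤ prodProb (layerWeight n s) {a | bitMatrix a ∈ S} := by
  classical
  refine measureReal_le_prodProb (fun i j => ?_) (fun a => le_of_eq ?_) S
  · have h1 : ∀ᵐ v ∂(uniformOn (signVectors n s)), v j = 1 ∨ v j = -1 := by
      rw [ae_iff, ← coe_image_layer, uniformOn_eq_zero_iff (Finset.finite_toSet _),
        coe_image_layer]
      ext v
      exact ⟨fun h => h.2 (h.1.1 j), fun h => h.elim⟩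
    rw [← (hX.law i).map_eq] at h1
    exact ae_of_ae_map (hX.law i).aemeasurable h1
  · have h1 : {ω | X ω = bitMatrix a} =
        ⋂ i ∈ Finset.univ, (fun ω => X ω i) ⁻¹' {fun j => boolSign (a i j)} := by
      ext ω
      simp only [Finset.mem_univ, Set.iInter_true, Set.mem_iInter, Set.mem_preimage,
        Set.mem_singleton_iff]
      exact funext_iff
    have h2 := (iIndepFun_iff_measure_inter_preimage_eq_mul.1 hX.indep) Finset.univ
      (sets := fun i => {fun j => boolSign (a i j)}) fun i _ => measurableSet_singleton _
    rw [← h1] at h2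
    rw [Measure.real, h2, ENNReal.toReal_prod]
    refine Finset.prod_congr rfl fun i _ => ?_
    rw [← uniformOn_signVectors_real_singleton, ← (hX.law i).map_eq, Measure.real,
      Measure.map_apply_of_aemeasurable (hX.law i).aemeasurable (measurableSet_singleton _)]

theorem bernoulliLaw_real_singleton {s : ℤ} (h : ∀ b, 0 ≤ bitWeight n s b) (b : Bool) :
    (bernoulliLaw n s).real {boolSign b} = bitWeight n s b := by
  have ht := h true
  have hf := h false
  simp only [bitWeight, boolSign] at ht hf
  cases b
  · simp [bernoulliLaw, Measure.real, boolSign, bitWeight] at hf ⊢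
    rw [ENNReal.toReal_ofReal (by linarith)]; ring
  · simp [bernoulliLaw, Measure.real, boolSign, bitWeight] at ht ⊢
    exact ht

theorem IsBernoulliMatrix.measureReal_le {s : ℤ} {X : Ω → Matrix (Fin n) (Fin n) ℤ}
    (hX : IsBernoulliMatrix P n s X) (hw : ∀ b, 0 ≤ bitWeight n s b)
    (S : Set (Matrix (Fin n) (Fin n) ℤ)) :
    P.real {ω | X ω ∈ S} ≤ prodProb (iidWeight n s) {a | bitMatrix a ∈ S} := by
  refine measureReal_le_prodProb (fun i j => ?_) (fun a => le_of_eq ?_) S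
  · have h1 : ∀ᵐ v ∂(bernoulliLaw n s), v = 1 ∨ v = -1 := by
      rw [ae_iff]
      simp [bernoulliLaw]
    rw [← (hX.law i j).map_eq] at h1
    exact ae_of_ae_map (hX.law i j).aemeasurable h1
  · have h1 : {ω | X ω = bitMatrix a} =
        ⋂ ij ∈ (Finset.univ : Finset (Fin n × Fin n)),
          (fun ω => X ω ij.1 ij.2) ⁻¹' {boolSign (a ij.1 ij.2)} := by
      ext ω
      simp only [Finset.mem_univ, Set.iInter_true, Set.mem_iInter, Set.mem_preimage,
        Set.mem_singleton_iff, Prod.forall]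
      exact ⟨fun h i j => congrFun (congrFun h i) j, fun h => funext fun i => funext fun j => h i j⟩
    have h2 := (iIndepFun_iff_measure_inter_preimage_eq_mul.1 hX.indep) Finset.univ
      (sets := fun ij => {boolSign (a ij.1 ij.2)}) fun i _ => measurableSet_singleton _
    rw [← h1] at h2
    rw [Measure.real, h2, ENNReal.toReal_prod, Fintype.prod_prod_type]
    refine Finset.prod_congr rfl fun i _ => Finset.prod_congr rfl fun j _ => ?_
    rw [← bernoulliLaw_real_singleton hw, ← (hX.law i j).map_eq, Measure.real,
      Measure.map_apply_of_aemeasurable (hX.law i j).aemeasurable (measurableSet_singleton _)]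

end Laws

/-! ### Choice of the parameters and conclusion -/

/-- Every asymptotic requirement below reduces to comparing powers of log n with n^(1/8). -/
theorem eventually_log_pow_le (A : ℝ) :
    ∀ᶠ n : ℕ in atTop, A ≤ Real.log n ∧ Real.log n ^ 20 ≤ (n : ℝ) ^ (1 / 8 : ℝ) := by
  have h1 : ∀ᶠ x : ℝ in atTop, A ≤ Real.log x := Real.tendsto_log_atTop.eventually_ge_atTop A
  have h2 := (isLittleO_log_rpow_rpow_atTop (20 : ℝ) (show (0 : ℝ) < 1 / 8 by norm_num)).bound
    (show (0 : ℝ) < 1 by norm_num)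
  have h3 : ∀ᶠ x : ℝ in atTop, A ≤ Real.log x ∧ Real.log x ^ 20 ≤ x ^ (1 / 8 : ℝ) := by
    filter_upwards [h1, h2, eventually_ge_atTop 1] with x hx0 hx hx1
    refine ⟨hx0, ?_⟩
    rw [one_mul, Real.norm_of_nonneg (Real.rpow_nonneg (zero_le_one.trans hx1) (1 / 8))] at hx
    refine le_trans ?_ hx
    have : Real.log x ^ (20 : ℝ) = Real.log x ^ 20 := by
      rw [← Real.rpow_natCast]; norm_num
    rw [this]
    exact Real.le_norm_self _
  exact (tendsto_natCast_atTop_atTop (R := ℝ)).eventually h3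

/-- The two volumes are close, with a failure probability stated explicitly. -/
theorem measureReal_rowVolume_close {n : ℕ} {Ω : Type*} [MeasurableSpace Ω] {P : Measure Ω}
    [IsProbabilityMeasure P] {ε : ℝ} (hε : 0 < ε) (hε1 : ε ≤ 1) (hn : 0 < n) {s : ℤ}
    (hs : |(s : ℝ)| ≤ (1 - ε) * n) {f : Fin n → ℤ} (hf : ∀ j, f j = 1 ∨ f j = -1) (z : ℂ)
    {X X' : Ω → Matrix (Fin n) (Fin n) ℤ} (hX : IsRowSumMatrix P n s X)
    (hX' : IsBernoulliMatrix P n s X') {τ α t δ β : ℝ} (hτ : 0 < τ) (hα : 0 < α) (ht : 0 ≤ t)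
    {k m : ℕ} (hkm : k ≤ m) (hm : m ≤ n)
    (hδ : t + (τ * k / α ^ 2 + (m - k : ℝ) * Real.log (τ + (2 + ‖z‖) ^ 2 * n)) ≤ δ)
    (hβ : n * (2 / ε * (n + 1) * Real.exp (-((ε / 2 * (n - k) - α ^ 2) / 16))) +
      n * (2 / ε * (n + 1) * Real.exp (-((ε / 2 * (n - m) - 1 ^ 2) / 16))) +
      2 * Real.exp (-(t ^ 2 / (2 * n * (4 * Real.sqrt n / Real.sqrt τ) ^ 2))) ≤ β) :
    1 - 2 * β ≤ P.real {ω |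
      0 < rowVolume m (shiftedMatrix f z (X ω)) ∧ 0 < rowVolume m (shiftedMatrix f z (X' ω)) ∧
      |Real.log (rowVolume m (shiftedMatrix f z (X ω))) -
        Real.log (rowVolume m (shiftedMatrix f z (X' ω)))| ≤
        δ + n * (1 / Real.sqrt τ * Real.sqrt (2 * (Real.sqrt n + 1)))} := by
  have hne := hX.layer_nonempty hn
  have hn1 : (1 : ℝ) ≤ n := by exact_mod_cast hn
  have hD : 1 ≤ 2 / ε * ((n : ℝ) + 1) := by
    have : 1 ≤ 2 / ε := by rw [le_div_iff₀ hε]; linarith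
    nlinarith
  set D := 2 / ε * ((n : ℝ) + 1) with hDdef
  set bad : ((Fin n → Bool) → ℝ) → Set (Matrix (Fin n) (Fin n) ℤ) := fun w =>
    {A | ¬ (0 < rowVolume m (shiftedMatrix f z A) ∧
      |2 * Real.log (rowVolume m (shiftedMatrix f z A)) -
        (prodExp w (rowLogDet τ m f z) + (m - n : ℝ) * Real.log τ)| ≤ δ)} with hbad
  have hmono : ∀ w : (Fin n → Bool) → ℝ, {a | bitMatrix a ∈ bad w} ⊆
      {a | ¬ (0 < rowVolume m (shiftedMatrix f z (bitMatrix a)) ∧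
      |2 * Real.log (rowVolume m (shiftedMatrix f z (bitMatrix a))) -
        (prodExp w (rowLogDet τ m f z) + (m - n : ℝ) * Real.log τ)| ≤
        t + (τ * k / α ^ 2 + (m - k : ℝ) * Real.log (τ + (2 + ‖z‖) ^ 2 * n)))} :=
    fun w a ha h => ha ⟨h.1, h.2.trans hδ⟩
  have hbd : ∀ w : (Fin n → Bool) → ℝ, (∀ x, 0 ≤ w x) → ∑ x, w x = 1 →
      (∀ x, w x ≤ D * iidWeight n s x) → prodProb w {a | bitMatrix a ∈ bad w} ≤ β :=
    fun w hw hw1 hwD => (prodProb_mono hw (hmono w)).trans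
      ((prodProb_not_rowVolume_le hε hn hs hw hw1 (by linarith) hwD hf z hτ hα ht hkm hm).trans hβ)
  have hw0 := iidWeight_nonneg hε hn hs
  have h1 : P.real {ω | X ω ∈ bad (layerWeight n s)} ≤ β :=
    (hX.measureReal_le _).trans (hbd _ (layerWeight_nonneg s) (sum_layerWeight hne)
      (layerWeight_le hε hε1 hn hs hne))
  -- Since D ≥ 1, the Bernoulli rows satisfy the same density bound and one β serves both models.
  have h2 : P.real {ω | X' ω ∈ bad (iidWeight n s)} ≤ β :=
    (hX'.measureReal_le (bitWeight_nonneg hε hn hs) _).trans (hbd _ hw0 (sum_iidWeight n s)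
      fun x => le_mul_of_one_le_left (hw0 x) hD)
  set good := {ω | 0 < rowVolume m (shiftedMatrix f z (X ω)) ∧
      0 < rowVolume m (shiftedMatrix f z (X' ω)) ∧
      |Real.log (rowVolume m (shiftedMatrix f z (X ω))) -
        Real.log (rowVolume m (shiftedMatrix f z (X' ω)))| ≤
        δ + n * (1 / Real.sqrt τ * Real.sqrt (2 * (Real.sqrt n + 1)))} with hgood
  have hcover : (Set.univ : Set Ω) ⊆ good ∪ ({ω | X ω ∈ bad (layerWeight n s)} ∪
      {ω | X' ω ∈ bad (iidWeight n s)}) := by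
    intro ω _
    by_cases hb : X ω ∈ bad (layerWeight n s)
    · exact Or.inr (Or.inl hb)
    by_cases hb' : X' ω ∈ bad (iidWeight n s)
    · exact Or.inr (Or.inr hb')
    obtain ⟨hp, hc⟩ := not_not.1 hb
    obtain ⟨hp', hc'⟩ := not_not.1 hb'
    refine Or.inl ⟨hp, hp', ?_⟩
    have h3 := abs_le.1 (abs_prodExp_rowLogDet_sub_le hε hn hs hne hτ m f z)
    -- The estimates concern twice the log-volumes, so halving leaves δ from the two deviations and
    -- half of the difference of means.
    have e : (n : ℝ) * (2 / Real.sqrt τ * Real.sqrt (2 * (Real.sqrt n + 1))) =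
        2 * (n * (1 / Real.sqrt τ * Real.sqrt (2 * (Real.sqrt n + 1)))) := by ring
    rw [e] at h3
    have h4 := abs_le.1 hc
    have h5 := abs_le.1 hc'
    rw [abs_le]
    constructor <;> linarith [h3.1, h3.2, h4.1, h4.2, h5.1, h5.2]
  have h3 : 1 ≤ P.real good + (P.real {ω | X ω ∈ bad (layerWeight n s)} +
      P.real {ω | X' ω ∈ bad (iidWeight n s)}) := by
    calc (1 : ℝ) = P.real Set.univ := probReal_univ.symm
      _ ≤ _ := (measureReal_mono hcover).trans ((measureReal_union_le _ _).trans
        (add_le_add le_rfl (measureReal_union_le _ _)))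
  linarith

set_option maxHeartbeats 1000000 in
/-- A choice of the parameters for which the two volumes are close with high probability. -/
theorem eventually_exists_parameters {ε : ℝ} (hε : 0 < ε) (z : ℂ) :
    ∀ᶠ n : ℕ in atTop, 0 < n ∧ threshold n ≤ n ∧ 0 < Real.log n ∧
      ∃ τ α t : ℝ, ∃ k : ℕ, 0 < τ ∧ 0 < α ∧ t = (n : ℝ) / Real.log n ^ 2 ∧ k ≤ threshold n ∧
      t + (τ * k / α ^ 2 + (threshold n - k : ℝ) * Real.log (τ + (2 + ‖z‖) ^ 2 * n)) ≤ 5 * t ∧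
      n * (1 / Real.sqrt τ * Real.sqrt (2 * (Real.sqrt n + 1))) ≤ t ∧
      n * (2 / ε * (n + 1) * Real.exp (-((ε / 2 * (n - k) - α ^ 2) / 16))) +
      n * (2 / ε * (n + 1) * Real.exp (-((ε / 2 * (n - threshold n) - 1 ^ 2) / 16))) +
      2 * Real.exp (-(t ^ 2 / (2 * n * (4 * Real.sqrt n / Real.sqrt τ) ^ 2))) ≤
        Real.exp (-(Real.log n ^ 2)) / 2 := by
  -- A sum of nonnegative thresholds, so that L ≥ A gives each lower bound on L at once.
  set A : ℝ := 10 + 256 / ε + 2 * Real.log (1 + (2 + ‖z‖) ^ 2) with hA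
  filter_upwards [eventually_log_pow_le A, eventually_gt_atTop 0] with n hL hn
  obtain ⟨hLA, hLy⟩ := hL
  set L := Real.log n with hLdef
  set y := (n : ℝ) ^ (1 / 8 : ℝ) with hy
  have hn' : (0 : ℝ) < n := by exact_mod_cast hn
  have hy8 : (n : ℝ) = y ^ 8 := by
    rw [hy, ← Real.rpow_natCast, ← Real.rpow_mul hn'.le]; norm_num
  have hlog0 : 0 ≤ Real.log (1 + (2 + ‖z‖) ^ 2) := Real.log_nonneg (by nlinarith [sq_nonneg (2 + ‖z‖)])
  have hε0 : 0 < 256 / ε := by positivity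
  have hL10 : 10 ≤ L := by linarith
  have hLε : 256 / ε ≤ L := by linarith
  have hLz : 2 * Real.log (1 + (2 + ‖z‖) ^ 2) ≤ L := by linarith
  have hL0 : 0 < L := by linarith
  have hL1 : 1 ≤ L := by linarith
  have hLe : 256 ≤ ε * L := by rw [div_le_iff₀ hε] at hLε; linarith
  have hpow : ∀ i, i ≤ 20 → L ^ i ≤ y := fun i hi => (pow_le_pow_right₀ hL1 hi).trans hLy
  have hy1 : 1 ≤ y := by simpa using hpow 0 (by norm_num)
  have hy0 : 0 < y := by linarith
  have hypow : ∀ i, 1 ≤ i → y ≤ y ^ i := fun i hi => le_self_pow₀ hy1 (by omega)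
  have hexpL : Real.exp L = n := Real.exp_log hn'
  -- τ = n^(3/4) exceeds √n, so that the comparison of means costs o(n), and is below n by enough to
  -- absorb the powers of log n in τk/α².
  set τ := y ^ 6 with hτ
  have hτ0 : 0 < τ := by positivity
  have hsqτ : Real.sqrt τ = y ^ 3 := by
    rw [hτ, show y ^ 6 = (y ^ 3) ^ 2 by ring, Real.sqrt_sq (by positivity)]
  have hsqn : Real.sqrt n = y ^ 4 := by
    rw [hy8, show y ^ 8 = (y ^ 4) ^ 2 by ring, Real.sqrt_sq (by positivity)]
  -- α² is half of (ε/2)(n/L³), so Talagrand's exponent stays positive when n - k ≥ n/L³.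
  set α := Real.sqrt (ε * n / (4 * L ^ 3)) with hα
  have hα2 : α ^ 2 = ε * n / (4 * L ^ 3) := Real.sq_sqrt (by positivity)
  have hα0 : 0 < α := Real.sqrt_pos.2 (by positivity)
  -- About n/L³ rows remain; at cost O(L) each they contribute O(n/L²), the order of the final
  -- error.
  set k := ⌊(n : ℝ) - n / L ^ 3⌋₊ with hk
  have hnL : L ^ 8 ≤ n / L ^ 3 := by
    rw [le_div_iff₀ (by positivity), ← pow_add, hy8]
    exact (hpow 11 (by norm_num)).trans (hypow 8 (by norm_num))
  have hnL' : n / L ^ 3 ≤ (n : ℝ) := div_le_self hn'.le (one_le_pow₀ hL1)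
  have hnL1 : 1 ≤ n / L ^ 3 := (one_le_pow₀ hL1).trans hnL
  have hkm : k ≤ threshold n := Nat.floor_mono (by linarith)
  have hkn : (k : ℝ) ≤ n - n / L ^ 3 := Nat.floor_le (by linarith)
  have hkn' : (n : ℝ) - n / L ^ 3 - 1 ≤ k := (Nat.sub_one_lt_floor _).le
  have hmn : (threshold n : ℝ) ≤ n - L ^ 8 := Nat.floor_le (by linarith)
  have hmn' : threshold n ≤ n := by
    have : (threshold n : ℝ) ≤ n := hmn.trans (by linarith [pow_pos hL0 8])
    exact_mod_cast this
  obtain ⟨t, ht⟩ : ∃ t, t = (n : ℝ) / L ^ 2 := ⟨_, rfl⟩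
  -- The constant 5 is 1 for the deviation, 1 for the dual basis, and 3 for the last rows: at most
  -- 2n/L³ of them at cost 3L/2 each.
  have hδ : t + (τ * k / α ^ 2 + (threshold n - k : ℝ) * Real.log (τ + (2 + ‖z‖) ^ 2 * n)) ≤
      5 * t := by
    have h1 : τ * k / α ^ 2 ≤ t := by
      calc τ * k / α ^ 2 ≤ τ * n / α ^ 2 := by gcongr; linarith
        _ = y ^ 6 * (4 * L ^ 3 / ε) := by rw [hα2, hτ]; field_simp
        _ ≤ t := by
          rw [ht, le_div_iff₀ (by positivity), hy8]
          have h3 : 4 / ε ≤ L := le_trans (by gcongr; norm_num) hLε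
          have h4 : 4 * L ^ 3 / ε * L ^ 2 ≤ y ^ 2 := by
            calc 4 * L ^ 3 / ε * L ^ 2 = 4 / ε * L ^ 5 := by ring
              _ ≤ L * L ^ 5 := by gcongr
              _ = L ^ 6 := by ring
              _ ≤ y ^ 2 := (hpow 6 (by norm_num)).trans (hypow 2 (by norm_num))
          calc _ = y ^ 6 * (4 * L ^ 3 / ε * L ^ 2) := by ring
            _ ≤ y ^ 6 * y ^ 2 := by gcongr
            _ = y ^ 8 := by ring
    have h2 : Real.log (τ + (2 + ‖z‖) ^ 2 * n) ≤ 3 / 2 * L := by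
      have h3 : τ + (2 + ‖z‖) ^ 2 * n ≤ (1 + (2 + ‖z‖) ^ 2) * n := by
        have : τ ≤ n := by rw [hτ, hy8]; exact pow_le_pow_right₀ hy1 (by norm_num)
        linarith
      have h4 := Real.log_le_log (by positivity) h3
      rw [Real.log_mul (by positivity) hn'.ne'] at h4
      linarith
    have h3 : (threshold n - k : ℝ) * Real.log (τ + (2 + ‖z‖) ^ 2 * n) ≤ 3 * t := by
      have h4 : (threshold n : ℝ) - k ≤ 2 * (n / L ^ 3) := by linarith [pow_pos hL0 8]
      have h5 : (0 : ℝ) ≤ threshold n - k := by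
        rw [sub_nonneg]; exact_mod_cast hkm
      calc _ ≤ (threshold n - k : ℝ) * (3 / 2 * L) := by gcongr
        _ ≤ 2 * (n / L ^ 3) * (3 / 2 * L) := by gcongr
        _ = 3 * t := by rw [ht]; field_simp
    linarith
  have hcouple : n * (1 / Real.sqrt τ * Real.sqrt (2 * (Real.sqrt n + 1))) ≤ t := by
    have h1 : Real.sqrt (2 * (Real.sqrt n + 1)) ≤ 2 * y ^ 2 := by
      rw [hsqn, Real.sqrt_le_left (by positivity)]
      have e : (2 * y ^ 2) ^ 2 = 2 * (y ^ 4 + y ^ 4) := by ring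
      rw [e]
      linarith [one_le_pow₀ hy1 (n := 4)]
    have h2 : 2 * L ^ 2 ≤ y := by
      calc 2 * L ^ 2 ≤ L * L ^ 2 := by gcongr; linarith
        _ = L ^ 3 := by ring
        _ ≤ y := hpow 3 (by norm_num)
    rw [hsqτ, ht, le_div_iff₀ (by positivity)]
    calc (n : ℝ) * (1 / y ^ 3 * Real.sqrt (2 * (Real.sqrt n + 1))) * L ^ 2
        ≤ n * (1 / y ^ 3 * (2 * y ^ 2)) * L ^ 2 := by gcongr
      _ = n * (2 * L ^ 2 / y) := by field_simp
      _ ≤ n * 1 := by gcongr; exact (div_le_one hy0).2 h2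
      _ = n := mul_one _
  obtain ⟨β, hβ⟩ : ∃ β, β = Real.exp (-(L ^ 2)) / 2 := ⟨_, rfl⟩
  have hexp : 5 * Real.exp (3 * L - L ^ 3) ≤ β := by
    have h1 : (11 : ℝ) ≤ Real.exp L := by linarith [Real.add_one_le_exp L]
    have h2 : 11 * Real.exp (3 * L - L ^ 3) ≤ Real.exp (-(L ^ 2)) := by
      calc _ ≤ Real.exp L * Real.exp (3 * L - L ^ 3) := by gcongr
        _ = Real.exp (L + (3 * L - L ^ 3)) := (Real.exp_add _ _).symm
        _ ≤ _ := Real.exp_le_exp.2 (by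
          have e : L + (3 * L - L ^ 3) - -(L ^ 2) = L * (4 + L - L * L) := by ring
          have e2 : L * L ≥ 10 * L := mul_le_mul_of_nonneg_right hL10 hL0.le
          have e3 : L * (4 + L - L * L) ≤ 0 :=
            mul_nonpos_of_nonneg_of_nonpos hL0.le (by linarith)
          linarith)
    rw [hβ]; linarith [Real.exp_pos (3 * L - L ^ 3)]
  -- The union bound over rows together with the density factor costs at most n³.
  have hnD : n * (2 / ε * ((n : ℝ) + 1)) ≤ Real.exp (3 * L) := by
    have h1 : Real.exp (3 * L) = (n : ℝ) ^ 3 := by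
      rw [show 3 * L = ((3 : ℕ) : ℝ) * L by norm_num, Real.exp_nat_mul, hexpL]
    have hn1 : (1 : ℝ) ≤ n := by exact_mod_cast hn
    have h2 : 4 / ε ≤ n := by
      rw [← hexpL]
      exact (le_trans (by gcongr; norm_num) hLε).trans (by linarith [Real.add_one_le_exp L])
    rw [h1]
    calc n * (2 / ε * ((n : ℝ) + 1)) ≤ n * (2 / ε * (n + n)) := by gcongr
      _ = 4 / ε * n ^ 2 := by ring
      _ ≤ n * n ^ 2 := by gcongr
      _ = (n : ℝ) ^ 3 := by ring
  have hprob : n * (2 / ε * (n + 1) * Real.exp (-((ε / 2 * (n - k) - α ^ 2) / 16))) +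
      n * (2 / ε * (n + 1) * Real.exp (-((ε / 2 * (n - threshold n) - 1 ^ 2) / 16))) +
      2 * Real.exp (-(t ^ 2 / (2 * n * (4 * Real.sqrt n / Real.sqrt τ) ^ 2))) ≤ β := by
    have key : ∀ x : ℝ, L ^ 3 ≤ x → n * (2 / ε * ((n : ℝ) + 1) * Real.exp (-x)) ≤
        Real.exp (3 * L - L ^ 3) := by
      intro x hx
      calc _ = n * (2 / ε * ((n : ℝ) + 1)) * Real.exp (-x) := by ring
        _ ≤ Real.exp (3 * L) * Real.exp (-L ^ 3) := by gcongr
        _ = _ := by rw [← Real.exp_add]; rfl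
    have h1 : L ^ 3 ≤ (ε / 2 * (n - k) - α ^ 2) / 16 := by
      have h4 : ε / 2 * (n / L ^ 3) ≤ ε / 2 * (n - k) := by gcongr; linarith
      have h5 : L ^ 8 * ε ≤ n / L ^ 3 * ε := by gcongr
      have h6 : α ^ 2 = ε / 4 * (n / L ^ 3) := by rw [hα2]; field_simp
      have h7 : 256 * L ^ 3 ≤ L ^ 8 * ε := by
        calc 256 * L ^ 3 ≤ ε * L * L ^ 3 * 1 := by rw [mul_one]; gcongr
          _ ≤ ε * L * L ^ 3 * L ^ 4 := by gcongr; exact one_le_pow₀ hL1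
          _ = _ := by ring
      rw [le_div_iff₀ (by norm_num)]
      linarith [pow_pos hL0 3]
    have h2 : L ^ 3 ≤ (ε / 2 * (n - threshold n) - 1 ^ 2) / 16 := by
      have h4 : ε / 2 * L ^ 8 ≤ ε / 2 * (n - threshold n) := by gcongr; linarith
      have h7 : 256 * L ^ 3 ≤ L ^ 8 * ε := by
        calc 256 * L ^ 3 ≤ ε * L * L ^ 3 * 1 := by rw [mul_one]; gcongr
          _ ≤ ε * L * L ^ 3 * L ^ 4 := by gcongr; exact one_le_pow₀ hL1
          _ = _ := by ring
      rw [le_div_iff₀ (by norm_num)]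
      have := one_le_pow₀ hL1 (n := 3)
      linarith
    have h3 : L ^ 3 - 3 * L ≤ t ^ 2 / (2 * n * (4 * Real.sqrt n / Real.sqrt τ) ^ 2) := by
      have e : t ^ 2 / (2 * n * (4 * Real.sqrt n / Real.sqrt τ) ^ 2) = y ^ 6 / (32 * L ^ 4) := by
        rw [hsqn, hsqτ, ht, hy8]
        field_simp
        ring
      rw [e, le_div_iff₀ (by positivity)]
      calc _ ≤ L ^ 3 * (32 * L ^ 4) := by gcongr; linarith
        _ ≤ L ^ 3 * (L ^ 2 * L ^ 4) := by
          gcongr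
          calc (32 : ℝ) ≤ 10 ^ 2 := by norm_num
            _ ≤ L ^ 2 := pow_le_pow_left₀ (by norm_num) hL10 2
        _ = L ^ 9 := by ring
        _ ≤ y ^ 6 := (hpow 9 (by norm_num)).trans (hypow 6 (by norm_num))
    have h4 : Real.exp (-(t ^ 2 / (2 * n * (4 * Real.sqrt n / Real.sqrt τ) ^ 2))) ≤
        Real.exp (3 * L - L ^ 3) := Real.exp_le_exp.2 (by linarith)
    have h5 := Real.exp_pos (3 * L - L ^ 3)
    linarith [key _ h1, key _ h2]
  exact ⟨hn, hmn', hL0, τ, α, t, k, hτ0, hα0, ht, hkm, hδ, hcouple, hβ ▸ hprob⟩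

theorem mainTheorem11 (ε : ℝ) (hε : 0 < ε) (hε1 : ε ≤ 1) (z : ℂ) :
    ∃ C : ℝ, 0 < C ∧ ∃ η : ℕ → ℝ, Tendsto η atTop (𝓝 0) ∧
      ∀ᶠ n : ℕ in atTop, ∀ s : ℤ, |(s : ℝ)| ≤ (1 - ε) * n →
        ∀ f : Fin n → ℤ, (∀ j, f j = 1 ∨ f j = -1) →
        ∀ (Ω : Type*) [MeasurableSpace Ω] (P : Measure Ω) [IsProbabilityMeasure P]
          (X X' : Ω → Matrix (Fin n) (Fin n) ℤ),
          IsRowSumMatrix P n s X → IsBernoulliMatrix P n s X' →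
          1 - Real.exp (-(Real.log n ^ (2 - η n))) ≤
            P.real {ω |
              0 < rowVolume (threshold n) (shiftedMatrix f z (X ω)) ∧
              0 < rowVolume (threshold n) (shiftedMatrix f z (X' ω)) ∧
              (1 / (n : ℝ)) *
                |Real.log (rowVolume (threshold n) (shiftedMatrix f z (X ω)))
                  - Real.log (rowVolume (threshold n) (shiftedMatrix f z (X' ω)))|
                ≤ C * (Real.log n ^ 2)⁻¹} := by
  -- 5t from the deviations and t from the means give C = 6. The failure probability is at most
  -- exp(-log² n), so η = 0.
  refine ⟨6, by norm_num, fun _ => 0, tendsto_const_nhds, ?_⟩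
  filter_upwards [eventually_exists_parameters hε z] with n
    ⟨hn, hmn, hL, τ, α, t, k, hτ, hα, ht, hkm, hδ, hcouple, hprob⟩
  intro s hs f hf Ω _ P _ X X' hX hX'
  have hn' : (0 : ℝ) < n := by exact_mod_cast hn
  have hmain := measureReal_rowVolume_close hε hε1 hn hs hf z hX hX' hτ hα
    (show 0 ≤ t by rw [ht]; positivity) hkm hmn hδ hprob
  rw [sub_zero, Real.rpow_two]
  refine le_trans (le_of_eq (by ring)) (hmain.trans (measureReal_mono ?_))
  rintro ω ⟨h1, h2, h3⟩
  refine ⟨h1, h2, ?_⟩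
  rw [one_div, inv_mul_le_iff₀ hn']
  refine h3.trans ((add_le_add le_rfl hcouple).trans (le_of_eq ?_))
  rw [ht]
  ring
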